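/- For a complex number $q$ with $0<|q|<1$ and an even integer $k\ge 4$, let $E_k(q)$ be the normalised Eisenstein series of weight $k$ on $\mathrm{SL}_2(\mathbb{Z})$, that is $$2\zeta(k)\,E_k(q)=\sum_{(m,n)\in\mathbb{Z}^2,\ (m,n)\neq(0,0)}\frac{1}{(m\tau+n)^{k}},\qquad q=e^{2i\pi\tau},\ \operatorname{Im}\tau>0,$$ or equivalently $E_k(q)=1-\frac{2k}{B_k}\sum_{n\ge1}\sigma_{k-1}(n)\,q^n$, where $\sigma_{k-1}(n)=\sum_{d\mid n}d^{k-1}$ and $B_k$ is the $k$-th Bernoulli number. Theorem. For every complex number $q\neq 0$ with $q\neq\pm1$ and $1/q\in\mathbb{Z}$, at least one of the two numbers $E_4(q)$ and $E_6(q)$ is transcendental over $\mathbb{Q}$. -/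

import Mathlib

/-- The normalised Eisenstein series `E_k` of level one and weight `k`, seen as a function of the
nome `q`: for `0 < |q| < 1` it is the value of the modular form `E_k` at any point `τ` of the upper
half plane such that `q = exp (2 * π * i * τ)`. -/
noncomputable def eisensteinE {k : ℕ} (hk : 3 ≤ k) (q : ℂ) : ℂ :=
  UpperHalfPlane.cuspFunction 1 (ModularForm.E hk) q

theorem eisensteinE_exp {k : ℕ} (hk : 3 ≤ k) (τ : UpperHalfPlane) :
    eisensteinE hk (Complex.exp (2 * Real.pi * Complex.I * τ)) = ModularForm.E hk τ := by
  have h := SlashInvariantFormClass.eq_cuspFunction (ModularForm.E hk) τ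
    one_mem_strictPeriods_SL one_ne_zero
  simpa [eisensteinE, Function.Periodic.qParam] using h

/-- `2 * ζ(k) * E_k` is the sum of `1 / (m * τ + n) ^ k` over the pairs of integers `(m, n)`
(in Lean the pair `(0, 0)` contributes `0`). -/
theorem two_mul_zeta_mul_eisensteinE {k : ℕ} (hk : 3 ≤ k) (τ : UpperHalfPlane) :
    2 * riemannZeta k * eisensteinE hk (Complex.exp (2 * Real.pi * Complex.I * τ)) =
      ∑' v : Fin 2 → ℤ, ((v 0 : ℂ) * τ + v 1) ^ (-(k : ℤ)) := by
  have h := tsum_eisSummand_eq_riemannZeta_mul_eisensteinSeries hk τ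
  simp only [EisensteinSeries.eisSummand] at h
  rw [h, eisensteinE_exp, show ModularForm.E hk τ =
    (1 / 2 : ℂ) • EisensteinSeries.eisensteinSeriesSIF (N := 1) 0 k τ from rfl,
    EisensteinSeries.eisensteinSeriesSIF_apply 0 k τ]
  simp only [smul_eq_mul]
  ring

/-- The Fourier expansion `E_k(q) = 1 - (2 * k / B_k) * ∑ σ_{k-1}(n) * q ^ n`. -/
theorem eisensteinE_exp_eq_tsum {k : ℕ} (hk : 3 ≤ k) (hk2 : Even k) (τ : UpperHalfPlane) :
    eisensteinE hk (Complex.exp (2 * Real.pi * Complex.I * τ)) =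
      1 - (2 * k / bernoulli k) * ∑' n : ℕ+, (ArithmeticFunction.sigma (k - 1) n : ℂ) *
        Complex.exp (2 * Real.pi * Complex.I * τ) ^ (n : ℤ) := by
  rw [eisensteinE_exp]
  exact EisensteinSeries.q_expansion_bernoulli hk hk2 τ

/-!
If `E₄(q)` and `E₆(q)` were both algebraic, where `q = 1 / N`, then the values of `E₄` and `E₆` at
all the points `q ^ 2 ^ s` would be algebraic too, with good control of their heights. An auxiliary
function of Mahler type, a polynomial in `q`, `E₄(q)`, `E₆(q)` with a high order of vanishing at
`q = 0`, turns this into a contradiction.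

* The lattice `ℤ + ℤ τ` has index two in `ℤ / 2 + ℤ τ`, so that the Eisenstein series of the second
  lattice are those of the first one plus the Taylor coefficients of `℘` at the half-period `1 / 2`.
  The differential equation of `℘` expresses these through `g₂`, `g₃` and `℘(1 / 2)`, which is a
  root of `4 x³ - g₂ x - g₃`. Hence (`exists_eisensteinE_sq`) `E₄(q²)` and `E₆(q²)` are polynomials
  in `E₄(q)`, `E₆(q)` and a root of a cubic. After `s` steps the values at `q ^ 2 ^ s` lie in a
  number field of degree `O(3 ^ s)`, and their denominators and conjugates, measured with the
  weights `4` and `6`, have grown by the factor `2 ^ s` only (`Controlled.eisensteinE_pow`).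
* Siegel's lemma gives a nonzero integer polynomial of degree less than `L = 2 K` in each of `q`,
  `E₄`, `E₆` whose `q`-expansion `F` vanishes to an order `M ≥ L³ / 2` (`exists_auxSeries`).
  The series `F` is not zero, because `q`, `E₄`, `E₆` are algebraically independent
  (`eq_zero_of_auxSeries_eq_zero`). The coefficients of `F` grow polynomially, so its leading term
  dominates at `q ^ n` as soon as `n = 2 ^ s` exceeds a constant times `L log M`; for the smallest
  such `s` the number `F(q ^ n)` is nonzero and about as small as `|N| ^ (-n M)`
  (`discEval_ne_zero_and_norm_le`).
* The points `q ^ n` are rational with denominator `N ^ n`, so Liouville's inequality in the number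
  field of degree `O(3 ^ s)` bounds `|F(q ^ n)|` from below by `|N| ^ (-O(3 ^ s n L))`
  (`Controlled.one_le_norm_mul_pow`). Therefore `M = O(3 ^ s L)` (`exists_order_le`). Since
  `3 ^ s ≤ n ^ (5 / 3)` this is `O(L ^ (8 / 3) (log M) ^ (5 / 3))`, which contradicts `M ≥ L³ / 2`
  when `L` is large (`not_forall_exists_order_le`).
-/

/-! ### Half-periods of the Weierstrass function -/

namespace PeriodPair

open Filter Topology

variable (L : PeriodPair)

theorem isPreconnected_compl_lattice : IsPreconnected ((L.lattice : Set ℂ)ᶜ) :=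
  (Set.Countable.isConnected_compl_of_one_lt_rank (by simp)
    (Set.countable_coe_iff.mp (inferInstanceAs (Countable L.lattice)))).2

theorem hasDerivAt_weierstrassP {z : ℂ} (hz : z ∉ L.lattice) :
    HasDerivAt L.weierstrassP (L.derivWeierstrassP z) z := by
  rw [← L.deriv_weierstrassP]
  exact (L.analyticOnNhd_weierstrassP z hz).differentiableAt.hasDerivAt

/-- `℘'` does not vanish identically, because `℘` has a pole. -/
theorem exists_derivWeierstrassP_ne_zero : ∃ z ∉ L.lattice, L.derivWeierstrassP z ≠ 0 := by
  by_contra! h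
  have hev : ∀ᶠ z in 𝓝[≠] (0 : ℂ), z ∉ L.lattice := by
    filter_upwards [self_mem_nhdsWithin, mem_nhdsWithin_of_mem_nhds
      (L.compl_lattice_sdiff_singleton_mem_nhds 0)] with w hw hw' hw''
    exact hw' ⟨hw'', hw⟩
  have h1 : deriv L.weierstrassP =ᶠ[𝓝[≠] (0 : ℂ)] 0 := by
    filter_upwards [hev] with z hz
    rw [L.deriv_weierstrassP]
    exact h z hz
  obtain ⟨c, hc⟩ := L.isClosed_lattice.isOpen_compl.exists_is_const_of_deriv_eq_zero
    L.isPreconnected_compl_lattice L.differentiableOn_weierstrassP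
    (fun z hz ↦ by rw [L.deriv_weierstrassP]; exact h z hz)
  have h2 : L.weierstrassP =ᶠ[𝓝[≠] (0 : ℂ)] fun _ ↦ c := by
    filter_upwards [hev] with z hz using hc z hz
  have h3 := meromorphicOrderAt_congr h2
  rw [L.order_weierstrassP 0 (zero_mem _)] at h3
  have h4 : (0 : WithTop ℤ) ≤ meromorphicOrderAt (fun _ : ℂ ↦ c) 0 :=
    AnalyticAt.meromorphicOrderAt_nonneg analyticAt_const
  rw [← h3] at h4
  exact absurd h4 (by decide)

/-- `℘'' = 6 ℘² - g₂ / 2`. The derivative of the relation `℘'² = 4 ℘³ - g₂ ℘ - g₃` gives this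
identity multiplied by `2 ℘'`, which can be cancelled because the complement of the lattice is
connected. -/
theorem deriv_derivWeierstrassP {z : ℂ} (hz : z ∉ L.lattice) :
    deriv L.derivWeierstrassP z = 6 * L.weierstrassP z ^ 2 - L.g₂ / 2 := by
  have hP := L.analyticOnNhd_weierstrassP
  have hD := L.analyticOnNhd_derivWeierstrassP
  have hD2 : AnalyticOnNhd ℂ (fun z ↦ deriv L.derivWeierstrassP z -
      (6 * L.weierstrassP z ^ 2 - L.g₂ / 2)) (L.lattice : Set ℂ)ᶜ := fun z hz ↦ by
    have h1 := hP z hz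
    have h2 := (hD z hz).deriv
    fun_prop
  have key := hD.eq_zero_or_eq_zero_of_mul_eq_zero hD2 (fun w hw ↦ ?_)
    L.isPreconnected_compl_lattice
  · rcases key with h | h
    · obtain ⟨w, hw, hw'⟩ := L.exists_derivWeierstrassP_ne_zero
      exact absurd (h w hw) hw'
    · exact sub_eq_zero.mp (h z hz)
  · have hd := (hD w hw).differentiableAt.hasDerivAt
    have hp := L.hasDerivAt_weierstrassP hw
    have e1 : (fun z ↦ L.derivWeierstrassP z ^ 2) =ᶠ[𝓝 w]
        fun z ↦ 4 * L.weierstrassP z ^ 3 - L.g₂ * L.weierstrassP z - L.g₃ := by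
      filter_upwards [L.isClosed_lattice.isOpen_compl.mem_nhds hw] with u hu
      exact L.derivWeierstrassP_sq u hu
    have h1 := (hd.fun_pow 2).congr_of_eventuallyEq e1.symm
    have h2 := (((hp.fun_pow 3).const_mul 4).sub (hp.const_mul L.g₂)).sub_const L.g₃
    have h3 := h1.unique h2
    push_cast at h3
    linear_combination h3 / 2

variable {L} {h : ℂ}

theorem derivWeierstrassP_half_period (h2 : 2 * h ∈ L.lattice) :
    L.derivWeierstrassP h = 0 := by
  have h1 := L.derivWeierstrassP_add_coe (-h) ⟨2 * h, h2⟩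
  rw [L.derivWeierstrassP_neg, show -h + ((⟨2 * h, h2⟩ : L.lattice) : ℂ) = h by
    simp only; ring] at h1
  linear_combination h1 / 2

/-- The values of `℘` at the half-periods are roots of `4 x³ - g₂ x - g₃`. -/
theorem weierstrassP_half_period_cubic (h1 : h ∉ L.lattice) (h2 : 2 * h ∈ L.lattice) :
    4 * L.weierstrassP h ^ 3 - L.g₂ * L.weierstrassP h - L.g₃ = 0 := by
  rw [← L.derivWeierstrassP_sq h h1, derivWeierstrassP_half_period h2]
  simp

theorem sumInvPow_four_of_notMem (h1 : h ∉ L.lattice) :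
    6 * L.sumInvPow h 4 = 6 * L.weierstrassP h ^ 2 - L.g₂ / 2 := by
  rw [← L.deriv_derivWeierstrassP h1, ← L.deriv_derivWeierstrassPExcept_self h,
    L.derivWeierstrassPExcept_of_notMem h h1]

/-- The fourth derivative of `℘` at a half-period. -/
theorem sumInvPow_six_half_period (h1 : h ∉ L.lattice) (h2 : 2 * h ∈ L.lattice) :
    5 * L.sumInvPow h 6 = 3 * L.weierstrassP h * L.sumInvPow h 4 := by
  have e := L.iteratedDeriv_derivWeierstrassPExcept_self h (n := 3)
  rw [L.derivWeierstrassPExcept_of_notMem h h1, iteratedDeriv_succ', iteratedDeriv_succ',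
    iteratedDeriv_one] at e
  have hn := L.isClosed_lattice.isOpen_compl.mem_nhds h1
  have e1 : deriv (deriv L.derivWeierstrassP) =ᶠ[𝓝 h]
      fun z ↦ 12 * (L.weierstrassP z * L.derivWeierstrassP z) := by
    filter_upwards [hn] with u hu
    have : deriv L.derivWeierstrassP =ᶠ[𝓝 u] fun z ↦ 6 * L.weierstrassP z ^ 2 - L.g₂ / 2 := by
      filter_upwards [L.isClosed_lattice.isOpen_compl.mem_nhds hu] with v hv
      exact L.deriv_derivWeierstrassP hv
    rw [this.deriv_eq,
      ((((L.hasDerivAt_weierstrassP hu).fun_pow 2).const_mul 6).sub_const _).deriv]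
    push_cast
    ring
  have hd := (L.analyticOnNhd_derivWeierstrassP h h1).differentiableAt.hasDerivAt
  rw [e1.deriv_eq, (((L.hasDerivAt_weierstrassP h1).fun_mul hd).const_mul 12).deriv,
    derivWeierstrassP_half_period h2, L.deriv_derivWeierstrassP h1,
    ← sumInvPow_four_of_notMem h1] at e
  have : (((3 + 2).factorial : ℕ) : ℂ) = 120 := by norm_num [Nat.factorial]
  rw [this] at e
  linear_combination -e / 24

end PeriodPair

/-! ### Eisenstein series and isogenies of degree two -/

section TwoIsogeny

open Complex hiding I
open UpperHalfPlane hiding I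

/-- The pair of periods `(1, τ)`. -/
noncomputable def UpperHalfPlane.periodPair (τ : ℍ) : PeriodPair where
  ω₁ := 1
  ω₂ := τ
  indep := by
    rw [LinearIndependent.pair_iff]
    intro s t h
    have h2 : t * τ.im = 0 := by simpa using congrArg Complex.im h
    have ht : t = 0 := by simpa [τ.im_ne_zero] using h2
    subst ht
    simpa using h

/-- The term of index `(m, n)` of the lattice `ℤ + ℤ τ` is `m τ + n`. -/
noncomputable def UpperHalfPlane.latticeEquiv (τ : ℍ) : (Fin 2 → ℤ) ≃ τ.periodPair.lattice :=
  ((finTwoArrowEquiv ℤ).trans (Equiv.prodComm ℤ ℤ)).trans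
    τ.periodPair.latticeEquivProd.symm.toEquiv

theorem UpperHalfPlane.latticeEquiv_apply (τ : ℍ) (v : Fin 2 → ℤ) :
    (τ.latticeEquiv v : ℂ) = v 0 * τ + v 1 := by
  have := τ.periodPair.latticeEquiv_symm_apply (v 1, v 0)
  simp only [UpperHalfPlane.periodPair, mul_one] at this
  rw [add_comm, ← this]
  rfl

theorem UpperHalfPlane.periodPair_G (τ : ℍ) {k : ℕ} (hk : 3 ≤ k) :
    τ.periodPair.G k = 2 * riemannZeta k * eisensteinE hk (exp (2 * Real.pi * Complex.I * τ)) := by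
  rw [two_mul_zeta_mul_eisensteinE, PeriodPair.G, ← τ.latticeEquiv.tsum_eq]
  simp [UpperHalfPlane.latticeEquiv_apply]

/-- The lattice spanned by `1 / 2` and `τ` is the disjoint union of `ℤ + ℤ τ` and its translate
by `-1 / 2`. -/
theorem two_pow_mul_eisensteinE_two_mul (τ : ℍ) {k : ℕ} (hk : 3 ≤ k) :
    2 ^ k * (2 * riemannZeta k * eisensteinE hk (exp (2 * Real.pi * Complex.I * τ) ^ 2)) =
      τ.periodPair.G k + τ.periodPair.sumInvPow (1 / 2) k := by
  let τ' : ℍ := ⟨2 * τ, by simpa using τ.im_pos⟩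
  have hq : exp (2 * Real.pi * Complex.I * τ) ^ 2 = exp (2 * Real.pi * Complex.I * τ') := by
    rw [← Complex.exp_nat_mul]
    congr 1
    change _ = 2 * Real.pi * Complex.I * (2 * τ)
    push_cast
    ring
  rw [hq, two_mul_zeta_mul_eisensteinE]
  have h0 := τ.periodPair.hasSum_sumInvPow 0 (r := k) (by omega)
  have h1 := τ.periodPair.hasSum_sumInvPow (1 / 2) (r := k) (by omega)
  rw [PeriodPair.sumInvPow_zero] at h0
  rw [← τ.latticeEquiv.hasSum_iff] at h0 h1
  let f : (Fin 2 → ℤ) → ℂ := fun v ↦ 2 ^ k * ((v 0 : ℂ) * τ' + v 1) ^ (-(k : ℤ))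
  let i (c : ℤ) (v : Fin 2 → ℤ) : Fin 2 → ℤ := ![v 0, 2 * v 1 - c]
  have hi (c : ℤ) : Function.Injective (i c) := fun v w h ↦ by
    have e0 := congrFun h 0
    have e1 := congrFun h 1
    simp only [i, Matrix.cons_val_zero, Matrix.cons_val_one] at e0 e1
    ext j
    fin_cases j
    · exact e0
    · simp only [Fin.mk_one]
      omega
  have hf (c : ℤ) (v : Fin 2 → ℤ) :
      f (i c v) = (((τ.latticeEquiv v : ℂ) - c / 2) ^ k)⁻¹ := by
    have hτ : (τ' : ℂ) = 2 * τ := rfl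
    simp only [f, i, Matrix.cons_val_zero, Matrix.cons_val_one, hτ, τ.latticeEquiv_apply]
    rw [zpow_neg, zpow_natCast, ← inv_inv ((2 : ℂ) ^ k), ← mul_inv, ← inv_pow, ← mul_pow]
    congr 2
    push_cast
    ring
  have g0 : HasSum (f ∘ i 0) (τ.periodPair.G k) := by
    convert h0 using 1
    ext v
    simp [hf]
  have g1 : HasSum (f ∘ i 1) (τ.periodPair.sumInvPow (1 / 2) k) := by
    convert h1 using 1
    ext v
    simp [hf]
  have hc : IsCompl (Set.range (i 0)) (Set.range (i 1)) := by
    suffices h : (Set.range (i 0))ᶜ = Set.range (i 1) from h ▸ isCompl_compl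
    ext v
    simp only [Set.mem_compl_iff, Set.mem_range, i]
    constructor
    · intro h
      refine ⟨![v 0, (v 1 + 1) / 2], ?_⟩
      have : v 1 % 2 ≠ 0 := fun h0 ↦ h ⟨![v 0, v 1 / 2], by
        ext j
        fin_cases j
        · simp
        · simp
          omega⟩
      ext j
      fin_cases j
      · simp
      · simp
        omega
    · rintro ⟨w, rfl⟩ ⟨u, hu⟩
      have := congrFun hu 1
      simp at this
      omega
  have := HasSum.add_isCompl hc ((hi 0).hasSum_range_iff.mpr g0) ((hi 1).hasSum_range_iff.mpr g1)
  rw [← this.tsum_eq, ← tsum_mul_left]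

theorem riemannZeta_six : riemannZeta 6 = (Real.pi : ℂ) ^ 6 / 945 := by
  have h := riemannZeta_two_mul_nat (k := 3) (by norm_num)
  have hb : bernoulli 6 = 1 / 42 := by
    decide +kernel
  norm_num [hb, Nat.factorial] at h
  rw [h]
  ring

theorem exists_exp_eq {q : ℂ} (hq0 : q ≠ 0) (hq1 : ‖q‖ < 1) :
    ∃ τ : ℍ, exp (2 * Real.pi * Complex.I * τ) = q := by
  have h1 : 0 < im (Function.Periodic.invQParam 1 q) :=
    Function.Periodic.im_invQParam_pos_of_norm_lt_one one_pos hq1 hq0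
  refine ⟨⟨Function.Periodic.invQParam 1 q, h1⟩, ?_⟩
  have := Function.Periodic.qParam_right_inv one_ne_zero hq0
  simpa [Function.Periodic.qParam] using this

/-- The values of `E₄` and `E₆` at `q ^ 2` are polynomials in the values at `q` and in a root `x`
of a cubic polynomial with coefficients in `ℤ[E₄(q), E₆(q)]`. With `q = exp (2πiτ)`,
this is the isogeny from `ℂ / (ℤ + ℤ τ)` to `ℂ / (ℤ / 2 + ℤ τ)`, and `π² / 3 * x = ℘(1 / 2)`. -/
theorem exists_eisensteinE_sq {q : ℂ} (hq0 : q ≠ 0) (hq1 : ‖q‖ < 1) :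
    ∃ x : ℂ,
      x ^ 3 = 3 * eisensteinE (k := 4) (by norm_num) q * x +
        2 * eisensteinE (k := 6) (by norm_num) q ∧
      16 * eisensteinE (k := 4) (by norm_num) (q ^ 2) =
        5 * x ^ 2 - 4 * eisensteinE (k := 4) (by norm_num) q ∧
      64 * eisensteinE (k := 6) (by norm_num) (q ^ 2) =
        11 * x ^ 3 - 12 * x * eisensteinE (k := 4) (by norm_num) q := by
  obtain ⟨τ, rfl⟩ := exists_exp_eq hq0 hq1
  have hh : (1 / 2 : ℂ) ∉ τ.periodPair.lattice := τ.periodPair.ω₁_div_two_notMem_lattice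
  have hh2 : 2 * (1 / 2 : ℂ) ∈ τ.periodPair.lattice := by
    simpa using! τ.periodPair.ω₁_mem_lattice
  have c := PeriodPair.weierstrassP_half_period_cubic hh hh2
  have s4 := PeriodPair.sumInvPow_four_of_notMem hh
  have s6 := PeriodPair.sumInvPow_six_half_period hh hh2
  have t4 := two_pow_mul_eisensteinE_two_mul τ (k := 4) (by norm_num)
  have t6 := two_pow_mul_eisensteinE_two_mul τ (k := 6) (by norm_num)
  simp only [PeriodPair.g₂, PeriodPair.g₃] at c s4
  rw [τ.periodPair_G (k := 4) (by norm_num)] at c s4 t4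
  rw [τ.periodPair_G (k := 6) (by norm_num)] at c t6
  push_cast at c s4 s6 t4 t6
  rw [riemannZeta_four] at c s4 t4
  rw [riemannZeta_six] at c t6
  generalize τ.periodPair.sumInvPow (1 / 2) 4 = S4 at *
  generalize τ.periodPair.sumInvPow (1 / 2) 6 = S6 at *
  generalize eisensteinE (k := 4) (by norm_num) (exp (2 * Real.pi * Complex.I * τ)) = a at *
  generalize eisensteinE (k := 6) (by norm_num) (exp (2 * Real.pi * Complex.I * τ)) = b at *
  generalize eisensteinE (k := 4) (by norm_num) (exp (2 * Real.pi * Complex.I * τ) ^ 2) = a' at *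
  generalize eisensteinE (k := 6) (by norm_num) (exp (2 * Real.pi * Complex.I * τ) ^ 2) = b' at *
  have hπ : (Real.pi : ℂ) ≠ 0 := by exact_mod_cast Real.pi_ne_zero
  obtain ⟨x, hx⟩ : ∃ x, τ.periodPair.weierstrassP (1 / 2) = Real.pi ^ 2 / 3 * x :=
    ⟨3 / Real.pi ^ 2 * τ.periodPair.weierstrassP (1 / 2), by field_simp⟩
  rw [hx] at c s4 s6
  generalize (Real.pi : ℂ) = p at *
  have e4 : S4 = p ^ 4 / 9 * (x ^ 2 - a) := by linear_combination s4 / 6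
  have e6 : S6 = p ^ 6 / 45 * x * (x ^ 2 - a) := by
    linear_combination s6 / 5 + p ^ 2 / 5 * x * e4
  have k1 : x ^ 3 = 3 * a * x + 2 * b := by
    apply mul_left_cancel₀ (pow_ne_zero 6 hπ)
    linear_combination 27 / 4 * c
  refine ⟨x, k1, ?_, ?_⟩
  · apply mul_left_cancel₀ (pow_ne_zero 4 hπ)
    linear_combination 45 * t4 + 45 * e4
  · apply mul_left_cancel₀ (pow_ne_zero 6 hπ)
    linear_combination 945 / 2 * t6 + 945 / 2 * e6 - p ^ 6 / 2 * k1

end TwoIsogeny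

/-! ### Power series with integer coefficients on the unit disc -/

section DiscSubring

open PowerSeries

/-- The ring of power series with integer coefficients which converge absolutely at every point of
the open unit disc. -/
def discSubring : Subring ℤ⟦X⟧ where
  carrier := {f | ∀ z : ℂ, ‖z‖ < 1 → Summable fun n ↦ ‖((coeff n f : ℤ) : ℂ) * z ^ n‖}
  mul_mem' {f g} hf hg z hz := by
    refine (summable_norm_sum_mul_antidiagonal_of_summable_norm (hf z hz) (hg z hz)).congr
      fun n ↦ congrArg _ (Eq.symm ?_)
    rw [coeff_mul]
    push_cast
    rw [Finset.sum_mul]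
    refine Finset.sum_congr rfl fun p hp ↦ ?_
    rw [← Finset.HasAntidiagonal.mem_antidiagonal.mp hp]
    ring
  one_mem' z hz := summable_of_ne_finset_zero (s := {0}) fun n hn ↦ by
    simp [coeff_one, Finset.notMem_singleton.mp hn]
  add_mem' {f g} hf hg z hz := by
    refine .of_nonneg_of_le (fun _ ↦ norm_nonneg _) (fun n ↦ ?_) ((hf z hz).add (hg z hz))
    rw [map_add, Int.cast_add, add_mul]
    exact norm_add_le _ _
  zero_mem' z hz := by simp
  neg_mem' {f} hf z hz := by simpa using hf z hz

/-- Evaluation at a point of the open unit disc. -/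
noncomputable def discEval (z : ℂ) (hz : ‖z‖ < 1) : discSubring →+* ℂ where
  toFun f := ∑' n, ((coeff n (f : ℤ⟦X⟧) : ℤ) : ℂ) * z ^ n
  map_one' := by
    rw [tsum_eq_single 0 fun n hn ↦ by simp [coeff_one, hn]]
    simp
  map_mul' f g := by
    rw [tsum_mul_tsum_eq_tsum_sum_antidiagonal_of_summable_norm (f.2 z hz) (g.2 z hz)]
    refine tsum_congr fun n ↦ ?_
    rw [Subring.coe_mul, coeff_mul]
    push_cast
    rw [Finset.sum_mul]
    refine Finset.sum_congr rfl fun p hp ↦ ?_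
    rw [← Finset.HasAntidiagonal.mem_antidiagonal.mp hp]
    ring
  map_zero' := by simp
  map_add' f g := by
    rw [← (f.2 z hz).of_norm.tsum_add (g.2 z hz).of_norm]
    refine tsum_congr fun n ↦ ?_
    rw [Subring.coe_add, map_add, Int.cast_add, add_mul]

theorem discEval_apply {z : ℂ} (hz : ‖z‖ < 1) (f : discSubring) :
    discEval z hz f = ∑' n, ((coeff n (f : ℤ⟦X⟧) : ℤ) : ℂ) * z ^ n := rfl

/-- The coefficient of index `n` of `f` is at most `C * (n + 1) ^ k` in absolute value. -/
def CoeffBound (f : ℤ⟦X⟧) (C : ℤ) (k : ℕ) : Prop :=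
  ∀ n, |coeff n f| ≤ C * (n + 1) ^ k

namespace CoeffBound

variable {f g : ℤ⟦X⟧} {C D : ℤ} {k l : ℕ}

theorem nonneg (hf : CoeffBound f C k) : 0 ≤ C := by
  simpa using (abs_nonneg _).trans (hf 0)

theorem one : CoeffBound 1 1 0 := fun n ↦ by
  rw [coeff_one]
  split_ifs <;> simp

theorem mul (hf : CoeffBound f C k) (hg : CoeffBound g D l) :
    CoeffBound (f * g) (C * D) (k + l + 1) := fun n ↦ by
  rw [coeff_mul]
  refine (Finset.abs_sum_le_sum_abs _ _).trans ?_
  refine (Finset.sum_le_card_nsmul _ _ ((C * (n + 1) ^ k) * (D * (n + 1) ^ l)) fun p hp ↦ ?_).trans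
    (le_of_eq ?_)
  · have := Finset.HasAntidiagonal.mem_antidiagonal.mp hp
    rw [abs_mul]
    have h1 : |coeff p.1 f| ≤ C * (n + 1) ^ k := (hf p.1).trans <| by
      have := hf.nonneg
      gcongr
      omega
    have h2 : |coeff p.2 g| ≤ D * (n + 1) ^ l := (hg p.2).trans <| by
      have := hg.nonneg
      gcongr
      omega
    exact mul_le_mul h1 h2 (abs_nonneg _) ((abs_nonneg _).trans h1)
  · rw [Finset.Nat.card_antidiagonal, nsmul_eq_mul]
    push_cast
    ring

theorem pow (hf : CoeffBound f C k) (j : ℕ) : CoeffBound (f ^ j) (C ^ j) ((k + 1) * j) := by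
  induction j with
  | zero => simpa using one
  | succ j ih =>
    rw [pow_succ, pow_succ]
    exact ih.mul hf

theorem X_pow_mul (hf : CoeffBound f C k) (i : ℕ) : CoeffBound (X ^ i * f) C k := fun n ↦ by
  have := hf.nonneg
  rw [coeff_X_pow_mul']
  split_ifs with h
  · refine (hf _).trans ?_
    gcongr
    omega
  · rw [abs_zero]
    positivity

theorem mono (hf : CoeffBound f C k) (hCD : C ≤ D) (hkl : k ≤ l) : CoeffBound f D l := fun n ↦ by
  have := hf.nonneg.trans hCD
  have hn : (1 : ℤ) ≤ n + 1 := by omega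
  refine (hf n).trans ?_
  gcongr

theorem mem_discSubring (hf : CoeffBound f C k) : f ∈ discSubring := fun z hz ↦ by
  have hC : (0 : ℝ) ≤ C := by exact_mod_cast hf.nonneg
  have hs := (summable_norm_pow_mul_geometric_of_norm_lt_one k hz).mul_left ((C : ℝ) * 2 ^ k)
  refine Summable.of_norm_bounded_eventually_nat hs ?_
  filter_upwards [Filter.eventually_ge_atTop 1] with n hn
  have h1 : |((coeff n f : ℤ) : ℝ)| ≤ C * (n + 1) ^ k := by exact_mod_cast hf n
  have h2 : ((n : ℝ) + 1) ^ k ≤ 2 ^ k * n ^ k := by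
    rw [← mul_pow]
    gcongr
    have : (1 : ℝ) ≤ n := by exact_mod_cast hn
    linarith
  rw [norm_norm, norm_mul, norm_mul, Complex.norm_intCast, norm_pow (n : ℂ), Complex.norm_natCast,
    ← mul_assoc, mul_assoc (C : ℝ)]
  gcongr
  exact h1.trans (by gcongr)

end CoeffBound

end DiscSubring

/-! ### The power series of `E₄` and `E₆` -/

section EisensteinSeries

open PowerSeries

/-- The series `1 + c * ∑ σ_k(n) X ^ n`. -/
noncomputable def sigmaSeries (c : ℤ) (k : ℕ) : ℤ⟦X⟧ :=
  PowerSeries.mk fun n ↦ if n = 0 then 1 else c * ArithmeticFunction.sigma k n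

theorem coeffBound_sigmaSeries {c : ℤ} (hc : 1 ≤ |c|) (k : ℕ) :
    CoeffBound (sigmaSeries c k) |c| (k + 1) := fun n ↦ by
  rw [sigmaSeries, coeff_mk]
  split_ifs with h
  · simpa [h] using hc
  · rw [abs_mul, Nat.abs_cast]
    gcongr
    have h1 := ArithmeticFunction.sigma_le_pow_succ k n
    have h2 : n ^ (k + 1) ≤ (n + 1) ^ (k + 1) := by gcongr; omega
    exact_mod_cast h1.trans h2

theorem discEval_sigmaSeries {c : ℤ} {k : ℕ} (h : sigmaSeries c k ∈ discSubring) {z : ℂ}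
    (hz : ‖z‖ < 1) : discEval z hz ⟨_, h⟩ =
      1 + c * ∑' n : ℕ+, (ArithmeticFunction.sigma k n : ℂ) * z ^ (n : ℤ) := by
  have hs := (h z hz).of_norm
  rw [discEval_apply, hs.tsum_eq_zero_add]
  simp only [zpow_natCast]
  rw [tsum_pnat_eq_tsum_succ (f := fun n ↦ (ArithmeticFunction.sigma k n : ℂ) * z ^ n),
    ← tsum_mul_left]
  simp [sigmaSeries, mul_assoc]

/-- The power series `1 + 240 ∑ σ₃(n) X ^ n` of `E₄`. -/
noncomputable def seriesE4 : discSubring :=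
  ⟨sigmaSeries 240 3, (coeffBound_sigmaSeries (by norm_num) 3).mem_discSubring⟩

/-- The power series `1 - 504 ∑ σ₅(n) X ^ n` of `E₆`. -/
noncomputable def seriesE6 : discSubring :=
  ⟨sigmaSeries (-504) 5, (coeffBound_sigmaSeries (by norm_num) 5).mem_discSubring⟩

/-- The identity power series, as an element of `discSubring`. -/
noncomputable def seriesX : discSubring :=
  ⟨X, CoeffBound.mem_discSubring (by simpa using CoeffBound.one.X_pow_mul 1)⟩

theorem discEval_seriesX {z : ℂ} (hz : ‖z‖ < 1) : discEval z hz seriesX = z := by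
  rw [discEval_apply, tsum_eq_single 1 fun n hn ↦ by simp [seriesX, coeff_X, hn]]
  simp [seriesX]

theorem discEval_seriesE4 {z : ℂ} (hz0 : z ≠ 0) (hz : ‖z‖ < 1) :
    discEval z hz seriesE4 = eisensteinE (k := 4) (by norm_num) z := by
  obtain ⟨τ, rfl⟩ := exists_exp_eq hz0 hz
  have hb : bernoulli 4 = -1 / 30 := by decide +kernel
  rw [seriesE4, discEval_sigmaSeries, eisensteinE_exp_eq_tsum _ ⟨2, rfl⟩, hb]
  push_cast
  ring

theorem discEval_seriesE6 {z : ℂ} (hz0 : z ≠ 0) (hz : ‖z‖ < 1) :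
    discEval z hz seriesE6 = eisensteinE (k := 6) (by norm_num) z := by
  obtain ⟨τ, rfl⟩ := exists_exp_eq hz0 hz
  have hb : bernoulli 6 = 1 / 42 := by decide +kernel
  rw [seriesE6, discEval_sigmaSeries, eisensteinE_exp_eq_tsum _ ⟨3, rfl⟩, hb]
  push_cast
  ring

/-! ### Values of `E₄` and `E₆` at the points equivalent to `i` -/

open Complex in
theorem eisensteinE_neg_inv {k : ℕ} (hk : 3 ≤ k) (τ : UpperHalfPlane) :
    eisensteinE hk (exp (2 * Real.pi * I * (-1 / (τ : ℂ)))) =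
      τ ^ k * eisensteinE hk (exp (2 * Real.pi * I * τ)) := by
  have h1 := SlashInvariantForm.slash_S_apply (ModularForm.E hk) k τ
  have h2 : SlashAction.map (k : ℤ) ModularGroup.S (ModularForm.E hk : UpperHalfPlane → ℂ) =
      ModularForm.E hk := by
    exact SlashInvariantForm.slash_action_eqn (ModularForm.E hk) _ ⟨ModularGroup.S, by simp⟩
  rw [h2, ← eisensteinE_exp, ← eisensteinE_exp] at h1
  have h3 : -1 / (τ : ℂ) = (-(τ : ℂ))⁻¹ := by
    rw [inv_neg, neg_div, one_div]
  rw [h3, h1, zpow_neg, zpow_natCast]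
  have := pow_ne_zero k τ.ne_zero
  field_simp

open Complex in
/-- Invariance of weight `k` under `τ ↦ -1 / (τ + t)`, at the point `τ = i`. -/
theorem eisensteinE_neg_inv_I_add {k : ℕ} (hk : 3 ≤ k) (t : ℕ) :
    eisensteinE hk (exp (2 * Real.pi * I * (-1 / (I + t)))) =
      (I + t) ^ k * eisensteinE hk (exp (2 * Real.pi * I * I)) := by
  have h := eisensteinE_neg_inv hk ⟨I + t, by simp⟩
  have h2 : exp (2 * Real.pi * I * (I + t)) = exp (2 * Real.pi * I * I) := by
    rw [mul_add, exp_add, mul_comm _ (t : ℂ), exp_nat_mul_two_pi_mul_I, mul_one]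
  exact h.trans (by rw [← h2])

open Complex in
/-- The point `i` is fixed by `τ ↦ -1 / τ`, and `i ^ 6 = -1`. -/
theorem eisensteinE_six_I :
    eisensteinE (k := 6) (by norm_num) (exp (2 * Real.pi * I * I)) = 0 := by
  have h := eisensteinE_neg_inv_I_add (k := 6) (by norm_num) 0
  have h6 : (I + (0 : ℕ)) ^ 6 = -1 := by
    rw [Nat.cast_zero, add_zero, show 6 = 4 + 2 by norm_num, pow_add, I_pow_four, I_sq, one_mul]
  have h1 : -1 / (I + (0 : ℕ)) = I := by
    rw [Nat.cast_zero, add_zero, div_I]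
    ring
  rw [h6, h1] at h
  linear_combination h / 2

open Complex in
/-- At `τ = i` the number `q` is positive, hence all terms of the series of `E₄` are. -/
theorem eisensteinE_four_I_ne_zero :
    eisensteinE (k := 4) (by norm_num) (exp (2 * Real.pi * I * I)) ≠ 0 := by
  have he : exp (2 * Real.pi * I * I) = (Real.exp (-2 * Real.pi) : ℝ) := by
    rw [ofReal_exp, mul_assoc, I_mul_I]
    push_cast
    ring_nf
  have hlt : ‖((Real.exp (-2 * Real.pi) : ℝ) : ℂ)‖ < 1 := by
    rw [norm_real, Real.norm_of_nonneg (Real.exp_pos _).le, Real.exp_lt_one_iff]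
    have := Real.pi_pos
    linarith
  rw [he, ← discEval_seriesE4 (by exact_mod_cast (Real.exp_pos _).ne') hlt, seriesE4,
    discEval_sigmaSeries]
  have h2 : ∑' n : ℕ+, (ArithmeticFunction.sigma 3 n : ℂ) *
      ((Real.exp (-2 * Real.pi) : ℝ) : ℂ) ^ (n : ℤ) =
      ((∑' n : ℕ+, (ArithmeticFunction.sigma 3 n : ℝ) *
        Real.exp (-2 * Real.pi) ^ (n : ℤ) : ℝ) : ℂ) := by
    push_cast
    rfl
  rw [h2]
  have h3 : (0 : ℝ) ≤ ∑' n : ℕ+, (ArithmeticFunction.sigma 3 n : ℝ) *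
      Real.exp (-2 * Real.pi) ^ (n : ℤ) := tsum_nonneg fun n ↦ by positivity
  intro h4
  have h5 : (1 : ℝ) + 240 * ∑' n : ℕ+, (ArithmeticFunction.sigma 3 n : ℝ) *
      Real.exp (-2 * Real.pi) ^ (n : ℤ) = 0 := by exact_mod_cast h4
  linarith

end EisensteinSeries

/-! ### Algebraic independence of `q`, `E₄` and `E₆` -/

section Independence

open Complex Filter Topology

theorem tendsto_inv_I_add_nat :
    Tendsto (fun t : ℕ ↦ 1 / (I + (t : ℂ))) atTop (𝓝[≠] 0) := by
  refine tendsto_nhdsWithin_iff.mpr ⟨?_, .of_forall fun t ↦ ?_⟩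
  · rw [tendsto_zero_iff_norm_tendsto_zero]
    refine squeeze_zero' (.of_forall fun _ ↦ norm_nonneg _) ?_
      (tendsto_const_div_atTop_nhds_zero_nat 1)
    filter_upwards [eventually_gt_atTop 0] with t ht
    rw [norm_div, norm_one]
    have h1 : (0 : ℝ) < t := by exact_mod_cast ht
    have h2 : (t : ℝ) ≤ ‖I + (t : ℂ)‖ := by
      have := Complex.abs_re_le_norm (I + (t : ℂ))
      simpa using this
    gcongr
  · have h : I + (t : ℂ) ≠ 0 := fun h ↦ by simpa using congrArg Complex.im h
    simpa using h

/-- A polynomial relation between `exp (-2πi / (i + t))` and `(i + t) ^ 4`, valid for all natural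
numbers `t`, is trivial: by the identity theorem it extends to a relation between `exp (-2πi x)`
and `x`, and the first of these functions is periodic while the second is not. -/
theorem eq_zero_of_forall_sum_exp_inv_I_add {L : ℕ} {a : ℕ → ℕ → ℂ} {c : ℂ} (hc : c ≠ 0)
    (h : ∀ t : ℕ, ∑ i ∈ Finset.range L, ∑ j ∈ Finset.range L,
      a i j * exp (2 * Real.pi * I * (-1 / (I + t))) ^ i * ((I + t) ^ 4 * c) ^ j = 0)
    {i j : ℕ} (hi : i < L) (hj : j < L) : a i j = 0 := by
  let g : ℂ → ℂ := fun x ↦ ∑ j ∈ Finset.range L, (∑ i ∈ Finset.range L,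
    a i j * exp (-(2 * Real.pi * I * x)) ^ i * c ^ j) * x ^ (4 * (L - j))
  have hg : AnalyticOnNhd ℂ g Set.univ := fun x _ ↦ by fun_prop
  have hg0 (t : ℕ) : g (1 / (I + t)) = 0 := by
    have h0 : I + (t : ℂ) ≠ 0 := fun h ↦ by simpa using congrArg Complex.im h
    have : g (1 / (I + t)) = (1 / (I + t)) ^ (4 * L) * ∑ i ∈ Finset.range L,
        ∑ j ∈ Finset.range L,
          a i j * exp (2 * Real.pi * I * (-1 / (I + t))) ^ i * ((I + t) ^ 4 * c) ^ j := by
      rw [Finset.sum_comm, Finset.mul_sum]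
      refine Finset.sum_congr rfl fun j hj ↦ ?_
      rw [Finset.mul_sum, Finset.sum_mul]
      refine Finset.sum_congr rfl fun i _ ↦ ?_
      obtain ⟨k, rfl⟩ := Nat.exists_eq_add_of_le (Finset.mem_range.mp hj).le
      have e1 : -(2 * Real.pi * I * (1 / (I + t))) = 2 * Real.pi * I * (-1 / (I + t)) := by ring
      rw [e1, Nat.add_sub_cancel_left, mul_add, pow_add, mul_pow, ← pow_mul, one_div, inv_pow,
        inv_pow]
      have := pow_ne_zero (4 * j) h0
      field_simp
    rw [this, h t, mul_zero]
  have hfreq : ∃ᶠ x in 𝓝[≠] (0 : ℂ), g x = 0 :=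
    tendsto_inv_I_add_nat.frequently (Frequently.of_forall hg0)
  have hgz : ∀ x, g x = 0 := fun x ↦
    hg.eqOn_zero_of_preconnected_of_frequently_eq_zero isPreconnected_univ (Set.mem_univ 0)
      hfreq (Set.mem_univ x)
  -- For fixed `x`, the function `g (x + m)` is polynomial in the integer `m`.
  have hcoef (x : ℂ) : ∑ i ∈ Finset.range L, a i j * exp (-(2 * Real.pi * I * x)) ^ i * c ^ j
      = 0 := by
    let p : Polynomial ℂ := ∑ j ∈ Finset.range L, Polynomial.C (∑ i ∈ Finset.range L,
      a i j * exp (-(2 * Real.pi * I * x)) ^ i * c ^ j) * Polynomial.X ^ (4 * (L - j))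
    have hp : p = 0 := by
      refine Polynomial.eq_zero_of_infinite_isRoot p
        ((Set.infinite_range_of_injective (f := fun m : ℕ ↦ x + m) fun m n h ↦ by
          simpa using h).mono ?_)
      rintro _ ⟨m, rfl⟩
      have he : exp (-(2 * Real.pi * I * (x + m))) = exp (-(2 * Real.pi * I * x)) := by
        rw [mul_add, neg_add, exp_add, exp_neg (_ * (m : ℂ)), mul_comm _ (m : ℂ),
          exp_nat_mul_two_pi_mul_I, inv_one, mul_one]
      have := hgz (x + m)
      simp only [g, he] at this
      simpa [p, Polynomial.IsRoot, Polynomial.eval_finsetSum] using this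
    have := congrArg (Polynomial.coeff · (4 * (L - j))) hp
    simp only [p, Polynomial.finsetSum_coeff, Polynomial.coeff_C_mul, Polynomial.coeff_X_pow,
      Polynomial.coeff_zero] at this
    rw [Finset.sum_eq_single j] at this
    · simpa using this
    · intro k hk hkj
      have := Finset.mem_range.mp hk
      rw [if_neg (by omega), mul_zero]
    · intro hj'
      exact absurd (Finset.mem_range.mpr hj) hj'
  let r : Polynomial ℂ := ∑ i ∈ Finset.range L, Polynomial.C (a i j) * Polynomial.X ^ i
  have hr : r = 0 := by
    refine Polynomial.eq_zero_of_infinite_isRoot r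
      ((Set.finite_singleton (0 : ℂ)).infinite_compl.mono fun u hu ↦ ?_)
    have h1 := hcoef (-(log u) / (2 * Real.pi * I))
    rw [mul_div_cancel₀ _ two_pi_I_ne_zero, neg_neg, exp_log hu, ← Finset.sum_mul] at h1
    have h2 := (mul_eq_zero.mp h1).resolve_right (pow_ne_zero _ hc)
    simpa [r, Polynomial.IsRoot, Polynomial.eval_finsetSum] using h2
  have := congrArg (Polynomial.coeff · i) hr
  simpa [r, Polynomial.coeff_X_pow, hi] using this

/-- The polynomial in `q`, `E₄` and `E₆` with coefficients `a i j l`, as a power series. -/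
noncomputable def auxSeries (L M : ℕ) (a : ℕ → ℕ → ℕ → ℤ) : discSubring :=
  ∑ l ∈ Finset.range M, (∑ i ∈ Finset.range L, ∑ j ∈ Finset.range L,
    (a i j l : discSubring) * seriesX ^ i * seriesE4 ^ j) * seriesE6 ^ l

theorem seriesE6_ne_zero : seriesE6 ≠ 0 := fun h ↦ by
  have := congrArg (fun f : discSubring ↦ PowerSeries.coeff 0 (f : PowerSeries ℤ)) h
  simp [seriesE6, sigmaSeries] at this

/-- Algebraic independence of `q`, `E₄` and `E₆`. The constant term in `E₆` of a relation vanishes,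
because `E₆` vanishes at the images `-1 / (i + t)` of the zero `i`. The relation can then be
divided by `E₆`. -/
theorem eq_zero_of_auxSeries_eq_zero {L M : ℕ} {a : ℕ → ℕ → ℕ → ℤ} (h : auxSeries L M a = 0)
    {i j l : ℕ} (hi : i < L) (hj : j < L) (hl : l < M) : a i j l = 0 := by
  induction M generalizing a l with
  | zero => omega
  | succ M ih =>
    have h0 : ∀ i < L, ∀ j < L, a i j 0 = 0 := by
      intro i hi j hj
      refine Int.cast_eq_zero.mp (eq_zero_of_forall_sum_exp_inv_I_add (L := L)
        (a := fun i j ↦ (a i j 0 : ℂ)) eisensteinE_four_I_ne_zero (fun t ↦ ?_) hi hj)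
      have hw0 := exp_ne_zero (2 * Real.pi * I * (-1 / (I + t)))
      have hw1 : ‖exp (2 * Real.pi * I * (-1 / (I + t)))‖ < 1 := by
        have := UpperHalfPlane.norm_exp_two_pi_I_lt_one
          (.mk _ (UpperHalfPlane.im_inv_neg_coe_pos ⟨I + t, by simp⟩))
        rw [show -1 / (I + (t : ℂ)) = (-(I + t))⁻¹ by rw [inv_neg, neg_div, one_div]]
        exact this
      have hd := congrArg (discEval _ hw1) h
      have h4 := eisensteinE_neg_inv_I_add (k := 4) (by norm_num) t
      have h6 := eisensteinE_neg_inv_I_add (k := 6) (by norm_num) t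
      rw [eisensteinE_six_I, mul_zero] at h6
      rw [auxSeries, Finset.sum_range_succ'] at hd
      simpa [discEval_seriesX, discEval_seriesE4 hw0, discEval_seriesE6 hw0, h6, h4,
        -mul_eq_zero] using hd
    cases l with
    | zero => exact h0 i hi j hj
    | succ l =>
      refine ih (a := fun i j l ↦ a i j (l + 1)) ?_ (by omega)
      have h1 : auxSeries L (M + 1) a =
          auxSeries L M (fun i j l ↦ a i j (l + 1)) * seriesE6 := by
        rw [auxSeries, Finset.sum_range_succ', Finset.sum_eq_zero (s := Finset.range L) (fun i hi ↦
          Finset.sum_eq_zero fun j hj ↦ by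
            rw [h0 i (Finset.mem_range.mp hi) j (Finset.mem_range.mp hj)]; simp)]
        rw [zero_mul, add_zero, auxSeries, Finset.sum_mul]
        simp only [pow_succ, mul_assoc]
      rw [h1] at h
      exact (mul_eq_zero.mp h).resolve_right seriesE6_ne_zero

end Independence

/-! ### The auxiliary function -/

section Auxiliary

open PowerSeries

theorem coeff_auxSeries (L M : ℕ) (a : ℕ → ℕ → ℕ → ℤ) (n : ℕ) :
    coeff n (auxSeries L M a : ℤ⟦X⟧) =
      ∑ l ∈ Finset.range M, ∑ i ∈ Finset.range L, ∑ j ∈ Finset.range L,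
        a i j l * coeff n (X ^ i * ((seriesE4 : ℤ⟦X⟧) ^ j * (seriesE6 : ℤ⟦X⟧) ^ l)) := by
  have h (m : ℤ) (f : ℤ⟦X⟧) : coeff n ((m : ℤ⟦X⟧) * f) = m * coeff n f := by
    rw [← zsmul_eq_mul, map_zsmul, smul_eq_mul]
  simp only [auxSeries, seriesX, AddSubmonoidClass.coe_finsetSum, Finset.sum_mul, map_sum,
    Subring.coe_mul, Subring.coe_pow, Subring.coe_intCast, mul_assoc, h]

/-- Each factor `E₄` or `E₆` contributes `504` to the constant and `6 + 1 = 7` to the exponent; there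
are at most `2 * L` factors. -/
theorem coeffBound_monomial {L j l : ℕ} (hj : j < L) (hl : l < L) (i : ℕ) :
    CoeffBound (X ^ i * ((seriesE4 : ℤ⟦X⟧) ^ j * (seriesE6 : ℤ⟦X⟧) ^ l))
      (504 ^ (2 * L)) (14 * L) := by
  have h4 : CoeffBound (seriesE4 : ℤ⟦X⟧) 504 6 :=
    (coeffBound_sigmaSeries (c := 240) (by norm_num) 3).mono (by norm_num) (by norm_num)
  have h6 : CoeffBound (seriesE6 : ℤ⟦X⟧) 504 6 :=
    (coeffBound_sigmaSeries (c := -504) (by norm_num) 5).mono (by norm_num) (by norm_num)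
  refine (((h4.pow j).mul (h6.pow l)).X_pow_mul i).mono ?_ (by omega)
  rw [← pow_add]
  exact pow_le_pow_right₀ (by norm_num) (by omega)

theorem coeffBound_auxSeries {L : ℕ} {a : ℕ → ℕ → ℕ → ℤ} {H : ℤ} (ha : ∀ i j l, |a i j l| ≤ H) :
    CoeffBound (auxSeries L L a : ℤ⟦X⟧) (L ^ 3 * H * 504 ^ (2 * L)) (14 * L) := fun n ↦ by
  have hH : 0 ≤ H := (abs_nonneg _).trans (ha 0 0 0)
  rw [coeff_auxSeries]
  have key (l : ℕ) (hl : l ∈ Finset.range L) (i : ℕ) (j : ℕ) (hj : j ∈ Finset.range L) :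
      |a i j l * coeff n (X ^ i * ((seriesE4 : ℤ⟦X⟧) ^ j * (seriesE6 : ℤ⟦X⟧) ^ l))| ≤
        H * (504 ^ (2 * L) * (n + 1) ^ (14 * L)) := by
    rw [abs_mul]
    exact mul_le_mul (ha i j l)
      (coeffBound_monomial (Finset.mem_range.mp hj) (Finset.mem_range.mp hl) i n) (abs_nonneg _) hH
  refine (Finset.abs_sum_le_sum_abs _ _).trans <|
    (Finset.sum_le_sum fun l hl ↦ (Finset.abs_sum_le_sum_abs _ _).trans <|
      Finset.sum_le_sum fun i _ ↦ (Finset.abs_sum_le_sum_abs _ _).trans <|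
      Finset.sum_le_sum fun j hj ↦ key l hl i j hj).trans (le_of_eq ?_)
  simp only [Finset.sum_const, Finset.card_range, nsmul_eq_mul]
  ring

attribute [local instance] Matrix.seminormedAddCommGroup in
/-- Siegel's lemma yields a nonzero polynomial in `q`, `E₄`, `E₆` of degree less than `2 K` in each
variable, with coefficients of controlled size, which vanishes at `q = 0` to order at least
`4 K ^ 3`, half the number of its coefficients. -/
theorem exists_auxSeries {K : ℕ} (hK : 0 < K) :
    ∃ a : ℕ → ℕ → ℕ → ℤ, auxSeries (2 * K) (2 * K) a ≠ 0 ∧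
      (∀ n < 4 * K ^ 3, coeff n (auxSeries (2 * K) (2 * K) a : ℤ⟦X⟧) = 0) ∧
      ∀ i j l, |a i j l| ≤ 8 * K ^ 3 * (504 ^ (4 * K) * (4 * K ^ 3) ^ (28 * K)) := by
  let A : Matrix (Fin (4 * K ^ 3)) (Fin (2 * K) × Fin (2 * K) × Fin (2 * K)) ℤ :=
    Matrix.of fun n b ↦ coeff (n : ℕ)
      (X ^ (b.1 : ℕ) * ((seriesE4 : ℤ⟦X⟧) ^ (b.2.1 : ℕ) * (seriesE6 : ℤ⟦X⟧) ^ (b.2.2 : ℕ)))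
  have hK3 : 0 < K ^ 3 := by positivity
  have hcard : Fintype.card (Fin (2 * K) × Fin (2 * K) × Fin (2 * K)) = 8 * K ^ 3 := by
    simp only [Fintype.card_prod, Fintype.card_fin]
    ring
  obtain ⟨t, ht0, hAt, ht⟩ := Int.Matrix.exists_ne_zero_int_vec_norm_le A
    (by rw [hcard, Fintype.card_fin]; omega) (by rw [Fintype.card_fin]; omega)
  have hexp : ((Fintype.card (Fin (4 * K ^ 3)) : ℕ) : ℝ) /
      ((Fintype.card (Fin (2 * K) × Fin (2 * K) × Fin (2 * K)) : ℕ) -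
        (Fintype.card (Fin (4 * K ^ 3)) : ℕ)) = 1 := by
    rw [hcard, Fintype.card_fin]
    have : (0 : ℝ) < K ^ 3 := by exact_mod_cast hK3
    push_cast
    field_simp
    norm_num
  rw [hexp, Real.rpow_one, hcard] at ht
  have hA : max 1 ‖A‖ ≤ 504 ^ (4 * K) * (4 * (K : ℝ) ^ 3) ^ (28 * K) := by
    have hK1 : (1 : ℝ) ≤ K := by exact_mod_cast hK
    have h1 : (1 : ℝ) ≤ K ^ 3 := one_le_pow₀ hK1
    refine max_le ?_ ((Matrix.norm_le_iff (by positivity)).mpr fun n b ↦ ?_)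
    · exact one_le_mul_of_one_le_of_one_le (one_le_pow₀ (by norm_num)) (one_le_pow₀ (by linarith))
    · have h2 := coeffBound_monomial b.2.1.2 b.2.2.2 (b.1 : ℕ) (n : ℕ)
      have h3 : ((n : ℕ) : ℤ) + 1 ≤ 4 * K ^ 3 := by exact_mod_cast n.2
      have h4 : |A n b| ≤ 504 ^ (2 * (2 * K)) * (4 * (K : ℤ) ^ 3) ^ (14 * (2 * K)) :=
        h2.trans (by gcongr)
      rw [Int.norm_eq_abs]
      rw [show 4 * K = 2 * (2 * K) by ring, show 28 * K = 14 * (2 * K) by ring]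
      exact_mod_cast h4
  let a : ℕ → ℕ → ℕ → ℤ := fun i j l ↦
    if h : i < 2 * K ∧ j < 2 * K ∧ l < 2 * K then t (⟨i, h.1⟩, ⟨j, h.2.1⟩, ⟨l, h.2.2⟩) else 0
  have ha (i j l : Fin (2 * K)) : a i j l = t (i, j, l) := by simp [a]
  refine ⟨a, fun h0 ↦ ht0 ?_, fun n hn ↦ ?_, fun i j l ↦ ?_⟩
  · ext ⟨i, j, l⟩
    rw [← ha]
    exact eq_zero_of_auxSeries_eq_zero h0 i.2 j.2 l.2
  · have h1 := congrFun hAt ⟨n, hn⟩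
    rw [coeff_auxSeries]
    simp only [Finset.sum_range, ha]
    simp only [Matrix.mulVec, dotProduct, Fintype.sum_prod_type, A, Matrix.of_apply,
      Pi.zero_apply] at h1
    rw [Finset.sum_comm, ← h1]
    refine Finset.sum_congr rfl fun i _ ↦ ?_
    rw [Finset.sum_comm]
    exact Finset.sum_congr rfl fun j _ ↦ Finset.sum_congr rfl fun l _ ↦ mul_comm _ _
  · by_cases h : i < 2 * K ∧ j < 2 * K ∧ l < 2 * K
    · simp only [a, dif_pos h]
      have h1 := (norm_le_pi_norm t (⟨i, h.1⟩, ⟨j, h.2.1⟩, ⟨l, h.2.2⟩)).trans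
        (ht.trans (mul_le_mul_of_nonneg_left hA (by positivity)))
      rw [Int.norm_eq_abs] at h1
      exact_mod_cast h1
    · simp only [a, dif_neg h, abs_zero]
      positivity

/-- Close enough to `0`, the value of a power series is comparable to its leading term. -/
theorem discEval_ne_zero_and_norm_le {f : discSubring} {T : ℤ} {k M : ℕ}
    (hf : CoeffBound (f : ℤ⟦X⟧) T k) (h0 : ∀ n < M, coeff n (f : ℤ⟦X⟧) = 0)
    (hM : coeff M (f : ℤ⟦X⟧) ≠ 0) {z : ℂ} (hz0 : z ≠ 0) (hz : ‖z‖ < 1)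
    (hzT : ‖z‖ * (4 * T * (2 * (M + 1)) ^ k) ≤ 1) :
    discEval z hz f ≠ 0 ∧ ‖discEval z hz f‖ ≤ ‖z‖ ^ M * (2 * T * (M + 1) ^ k) := by
  set c : ℕ → ℂ := fun n ↦ ((coeff n (f : ℤ⟦X⟧) : ℤ) : ℂ) with hc
  set r := ‖z‖ with hr
  have hr0 : 0 ≤ r := norm_nonneg _
  have hs : Summable fun n ↦ c n * z ^ n := (f.2 z hz).of_norm
  have hs' : Summable fun n ↦ c (n + (M + 1)) * z ^ n := by
    have h1 := (summable_nat_add_iff (M + 1)).mpr hs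
    refine (h1.mul_left (z ^ (M + 1))⁻¹).congr fun n ↦ ?_
    rw [pow_add z n]
    have := pow_ne_zero (M + 1) hz0
    field_simp
  have hval : discEval z hz f = z ^ M * (c M + z * ∑' n, c (n + (M + 1)) * z ^ n) := by
    rw [discEval_apply]
    change ∑' n, c n * z ^ n = _
    rw [← hs.sum_add_tsum_nat_add (M + 1), Finset.sum_range_succ, Finset.sum_eq_zero fun n hn ↦ by
      simp [hc, h0 n (Finset.mem_range.mp hn)], zero_add, mul_add, ← mul_assoc, ← pow_succ,
      ← tsum_mul_left]
    congr 1
    · ring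
    · refine tsum_congr fun n ↦ ?_
      rw [pow_add]
      ring
  have hcM : (1 : ℝ) ≤ ‖c M‖ := by
    rw [hc, Complex.norm_intCast]
    exact_mod_cast Int.one_le_abs hM
  have hcn (n : ℕ) : ‖c n‖ ≤ T * (n + 1) ^ k := by
    rw [hc, Complex.norm_intCast]
    exact_mod_cast hf n
  have hT : (1 : ℝ) ≤ T := by
    have h1 := hf.nonneg
    have h2 : T ≠ 0 := by
      rintro rfl
      have := hf M
      rw [zero_mul] at this
      exact hM (abs_nonpos_iff.mp this)
    exact_mod_cast (by omega : 1 ≤ T)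
  have hMk : (1 : ℝ) ≤ (M + 1) ^ k := one_le_pow₀ (by linarith [(Nat.cast_nonneg M : (0 : ℝ) ≤ M)])
  have h2k : 2 ^ k * r ≤ 1 / 2 := by
    rw [mul_pow] at hzT
    have h4 : r * (4 * T * (2 ^ k * (M + 1) ^ k)) = (2 ^ k * r) * (4 * (T * (M + 1) ^ k)) := by
      ring
    rw [h4] at hzT
    have h5 : 1 ≤ (T : ℝ) * (M + 1) ^ k := one_le_mul_of_one_le_of_one_le hT hMk
    have h6 : 0 ≤ 2 ^ k * r := by positivity
    nlinarith
  have hgeom : HasSum (fun n : ℕ ↦ (T : ℝ) * (2 * (M + 1)) ^ k * (1 / 2 : ℝ) ^ n)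
      ((T : ℝ) * (2 * (M + 1)) ^ k * 2) := hasSum_geometric_two.mul_left _
  have htail : ‖∑' n, c (n + (M + 1)) * z ^ n‖ ≤ T * (2 * (M + 1)) ^ k * 2 := by
    refine tsum_of_norm_bounded hgeom fun n ↦ ?_
    rw [norm_mul, norm_pow]
    have h1 : ((n + (M + 1) : ℕ) : ℝ) + 1 ≤ 2 * (M + 1) * 2 ^ n := by
      have h2 : n + 1 ≤ 2 ^ n := Nat.lt_two_pow_self
      have h3 : (n : ℝ) + 1 ≤ 2 ^ n := by exact_mod_cast h2
      push_cast
      nlinarith [(Nat.cast_nonneg M : (0 : ℝ) ≤ M), (Nat.cast_nonneg n : (0 : ℝ) ≤ n)]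
    calc ‖c (n + (M + 1))‖ * r ^ n
        ≤ T * (2 * (M + 1) * 2 ^ n) ^ k * r ^ n := by
          gcongr
          refine (hcn _).trans ?_
          gcongr
      _ = T * (2 * (M + 1)) ^ k * (2 ^ k * r) ^ n := by
          rw [mul_pow _ ((2 : ℝ) ^ n), mul_pow ((2 : ℝ) ^ k), ← pow_mul, ← pow_mul, mul_comm n k]
          ring
      _ ≤ _ := by gcongr
  have htail' : ‖z * ∑' n, c (n + (M + 1)) * z ^ n‖ ≤ 1 / 2 := by
    rw [norm_mul]
    have := mul_le_mul_of_nonneg_left htail hr0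
    linarith
  constructor
  · rw [hval]
    refine mul_ne_zero (pow_ne_zero _ hz0) fun h ↦ ?_
    rw [eq_neg_of_add_eq_zero_left h, norm_neg] at hcM
    linarith
  · rw [hval, norm_mul, norm_pow]
    gcongr
    refine (norm_add_le _ _).trans ?_
    have h1 := hcn M
    have h2 : 1 ≤ (T : ℝ) * (M + 1) ^ k := one_le_mul_of_one_le_of_one_le hT hMk
    linarith

end Auxiliary

/-! ### A tower of number fields -/

section Tower

open Module

/-- Liouville's inequality: the norm of a nonzero algebraic integer is at least `1`. -/
theorem one_le_norm_mul_pow_of_isIntegral {K : Type*} [Field K] [NumberField K] (φ : K →+* ℂ)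
    {x : K} (hx : IsIntegral ℤ x) (hx0 : x ≠ 0) {B : ℝ} (hB : ∀ σ : K →+* ℂ, ‖σ x‖ ≤ B) :
    1 ≤ ‖φ x‖ * B ^ (finrank ℚ K - 1) := by
  classical
  obtain ⟨n, hn⟩ := IsIntegrallyClosed.isIntegral_iff.mp (Algebra.isIntegral_norm ℚ hx)
  have hn0 : n ≠ 0 := by
    rintro rfl
    rw [map_zero, eq_comm, Algebra.norm_eq_zero_iff] at hn
    exact hx0 hn
  have h1 := Algebra.norm_eq_prod_embeddings ℚ ℂ x
  rw [← hn] at h1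
  have h2 : (1 : ℝ) ≤ ‖∏ σ : K →ₐ[ℚ] ℂ, σ x‖ := by
    rw [← h1]
    simpa using (by exact_mod_cast Int.one_le_abs hn0 : (1 : ℝ) ≤ |(n : ℝ)|)
  let φ' : K →ₐ[ℚ] ℂ := φ.toRatAlgHom
  rw [← Finset.mul_prod_erase _ _ (Finset.mem_univ φ'), norm_mul, norm_prod] at h2
  refine h2.trans (mul_le_mul_of_nonneg_left ?_ (norm_nonneg _))
  refine (Finset.prod_le_prod (fun _ _ ↦ norm_nonneg _) fun σ _ ↦ hB σ.toRingHom).trans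
    (le_of_eq ?_)
  rw [Finset.prod_const, Finset.card_erase_of_mem (Finset.mem_univ _), Finset.card_univ,
    AlgHom.card]

theorem exists_monic_of_cubic {R A : Type*} [CommRing R] [Nontrivial R] [CommRing A] [Algebra R A]
    {y : A} {p r : R} (h : y ^ 3 = algebraMap R A p * y + algebraMap R A r) :
    ∃ f : Polynomial R, f.Monic ∧ f.natDegree = 3 ∧ Polynomial.aeval y f = 0 := by
  refine ⟨Polynomial.X ^ 3 - (Polynomial.C p * Polynomial.X + Polynomial.C r), ?_, ?_, ?_⟩
  · exact Polynomial.monic_X_pow_sub (Polynomial.degree_linear_le.trans_lt (by norm_num))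
  · compute_degree!
  · simp [h]

theorem IsIntegral.of_cubic {y p r : ℂ} (hp : IsIntegral ℤ p) (hr : IsIntegral ℤ r)
    (h : y ^ 3 = p * y + r) : IsIntegral ℤ y := by
  obtain ⟨f, hf, -, hf0⟩ := exists_monic_of_cubic (R := integralClosure ℤ ℂ)
    (p := ⟨p, hp⟩) (r := ⟨r, hr⟩) h
  exact isIntegral_trans (R := ℤ) (A := integralClosure ℤ ℂ) y ⟨f, hf, hf0⟩

/-- The numbers `a` and `b`, of weights `4` and `6`, lie in a number field of degree at most `m`,
they have weighted denominator `u`, and their conjugates have weighted size at most `R`. -/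
def Controlled (u : ℕ) (R : ℝ) (m : ℕ) (a b : ℂ) : Prop :=
  IsIntegral ℤ ((u : ℂ) ^ 4 * a) ∧ IsIntegral ℤ ((u : ℂ) ^ 6 * b) ∧
    ∃ K : IntermediateField ℚ ℂ, FiniteDimensional ℚ K ∧ finrank ℚ K ≤ m ∧
      ∃ (ha : a ∈ K) (hb : b ∈ K), ∀ σ : K →+* ℂ,
        ‖σ ⟨a, ha⟩‖ ≤ R ^ 4 ∧ ‖σ ⟨b, hb⟩‖ ≤ R ^ 6

theorem exists_nat_mul_isIntegral {a : ℂ} (ha : IsAlgebraic ℚ a) :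
    ∃ d : ℕ, 0 < d ∧ IsIntegral ℤ ((d : ℂ) * a) := by
  obtain ⟨y, hy0, hy⟩ :=
    ((IsFractionRing.isAlgebraic_iff ℤ ℚ ℂ).mpr ha).exists_integral_multiple
  refine ⟨y.natAbs, Int.natAbs_pos.mpr hy0, ?_⟩
  rcases Int.natAbs_eq y with h | h
  · rw [h, zsmul_eq_mul] at hy
    simpa using hy
  · rw [h, zsmul_eq_mul] at hy
    simpa using hy.neg

theorem exists_controlled {a b : ℂ} (ha : IsAlgebraic ℚ a) (hb : IsAlgebraic ℚ b) :
    ∃ (u : ℕ) (R : ℝ) (m : ℕ), 0 < u ∧ 1 ≤ R ∧ 0 < m ∧ Controlled u R m a b := by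
  obtain ⟨d, hd, ia⟩ := exists_nat_mul_isIntegral ha
  obtain ⟨e, he, ib⟩ := exists_nat_mul_isIntegral hb
  let K : IntermediateField ℚ ℂ := IntermediateField.adjoin ℚ {a, b}
  have hK : FiniteDimensional ℚ K :=
    IntermediateField.finiteDimensional_adjoin_pair ha.isIntegral hb.isIntegral
  have hNF : NumberField K := ⟨⟩
  have ha' : a ∈ K := IntermediateField.subset_adjoin _ _ (by simp)
  have hb' : b ∈ K := IntermediateField.subset_adjoin _ _ (by simp)
  let R : ℝ := 1 + ∑ σ : K →+* ℂ, (‖σ ⟨a, ha'⟩‖ + ‖σ ⟨b, hb'⟩‖)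
  have hR : 1 ≤ R := le_add_of_nonneg_right (Finset.sum_nonneg fun _ _ ↦ by positivity)
  have hσ (σ : K →+* ℂ) : ‖σ ⟨a, ha'⟩‖ + ‖σ ⟨b, hb'⟩‖ ≤ R := by
    have := Finset.single_le_sum (f := fun σ : K →+* ℂ ↦ ‖σ ⟨a, ha'⟩‖ + ‖σ ⟨b, hb'⟩‖)
      (fun _ _ ↦ by positivity) (Finset.mem_univ σ)
    simp only [R]
    linarith
  refine ⟨d * e, R, finrank ℚ K, by positivity, hR, finrank_pos, ?_, ?_, K, hK, le_rfl, ha', hb',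
    fun σ ↦ ⟨?_, ?_⟩⟩
  · rw [show ((d * e : ℕ) : ℂ) ^ 4 * a = (d ^ 3 * e ^ 4 : ℕ) * (d * a) by push_cast; ring]
    exact (isIntegral_natCast _).mul ia
  · rw [show ((d * e : ℕ) : ℂ) ^ 6 * b = (d ^ 6 * e ^ 5 : ℕ) * (e * b) by push_cast; ring]
    exact (isIntegral_natCast _).mul ib
  · have h1 := le_self_pow₀ hR (show 4 ≠ 0 by norm_num)
    linarith [hσ σ, norm_nonneg (σ ⟨b, hb'⟩)]
  · have h1 := le_self_pow₀ hR (show 6 ≠ 0 by norm_num)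
    linarith [hσ σ, norm_nonneg (σ ⟨a, ha'⟩)]

/-- The roots of `x³ = 3 a x + 2 b` have weight `2` when `a` and `b` have the weights `4` and `6`. -/
theorem norm_le_of_cubic {R : ℝ} {a b x : ℂ} (ha : ‖a‖ ≤ R ^ 4) (hb : ‖b‖ ≤ R ^ 6)
    (hx : x ^ 3 = 3 * a * x + 2 * b) : ‖x‖ ≤ 2 * R ^ 2 := by
  by_contra! h
  have h1 : ‖x‖ ^ 3 ≤ 3 * R ^ 4 * ‖x‖ + 2 * R ^ 6 := by
    rw [← norm_pow, hx]
    refine (norm_add_le _ _).trans ?_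
    rw [norm_mul, norm_mul, norm_mul]
    norm_num
    gcongr
  have h2 : (2 * R ^ 2) ^ 2 * ‖x‖ < ‖x‖ ^ 2 * ‖x‖ := by
    have : 0 < ‖x‖ := lt_of_le_of_lt (by positivity) h
    gcongr
  have h3 : R ^ 4 * (2 * R ^ 2) ≤ R ^ 4 * ‖x‖ := by gcongr
  nlinarith

/-- Passage from `q` to `q ^ 2`: the degree is multiplied by `3`, while the weighted denominator and
the weighted size only double. -/
theorem Controlled.step {u : ℕ} {R : ℝ} {m : ℕ} {a b a' b' x : ℂ} (h : Controlled u R m a b)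
    (hx : x ^ 3 = 3 * a * x + 2 * b) (ha' : 16 * a' = 5 * x ^ 2 - 4 * a)
    (hb' : 64 * b' = 11 * x ^ 3 - 12 * x * a) :
    Controlled (2 * u) (2 * R) (3 * m) a' b' := by
  obtain ⟨ia, ib, K, hK, hm, ha, hb, hσ⟩ := h
  have hnat (n : ℕ) : IsIntegral ℤ (n : ℂ) := isIntegral_natCast n
  have ix : IsIntegral ℤ ((u : ℂ) ^ 2 * x) := by
    refine IsIntegral.of_cubic ((hnat 3).mul ia) ((hnat 2).mul ib) ?_
    push_cast
    linear_combination (u : ℂ) ^ 6 * hx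
  refine ⟨?_, ?_, ?_⟩
  · have e : ((2 * u : ℕ) : ℂ) ^ 4 * a' = (5 : ℕ) * (u ^ 2 * x) ^ 2 - (4 : ℕ) * (u ^ 4 * a) := by
      push_cast
      linear_combination (u : ℂ) ^ 4 * ha'
    rw [e]
    exact ((hnat 5).mul (ix.pow 2)).sub ((hnat 4).mul ia)
  · have e : ((2 * u : ℕ) : ℂ) ^ 6 * b' =
        (11 : ℕ) * (u ^ 2 * x) ^ 3 - (12 : ℕ) * (u ^ 2 * x * (u ^ 4 * a)) := by
      push_cast
      linear_combination (u : ℂ) ^ 6 * hb'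
    rw [e]
    exact ((hnat 11).mul (ix.pow 3)).sub ((hnat 12).mul (ix.mul ia))
  · obtain ⟨f, hf, hf3, hf0⟩ := exists_monic_of_cubic (R := K) (A := ℂ) (y := x)
      (p := 3 * ⟨a, ha⟩) (r := 2 * ⟨b, hb⟩) (by simpa using! hx)
    have hxK : IsIntegral K x := ⟨f, hf, hf0⟩
    have hdeg : finrank K (IntermediateField.adjoin K {x}) ≤ 3 := by
      rw [IntermediateField.adjoin.finrank hxK, ← hf3]
      exact Polynomial.natDegree_le_of_dvd (minpoly.dvd K x hf0) hf.ne_zero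
    have hfin := IntermediateField.adjoin.finiteDimensional hxK
    let K' : IntermediateField ℚ ℂ := (IntermediateField.adjoin K {x}).restrictScalars ℚ
    have hKK' : K ≤ K' := fun y hy ↦
      (IntermediateField.adjoin K {x}).algebraMap_mem ⟨y, hy⟩
    have hxK' : x ∈ K' := IntermediateField.mem_adjoin_simple_self K x
    have haK' := hKK' ha
    have hbK' := hKK' hb
    have ea : a' = (5 * x ^ 2 - 4 * a) / 16 := by linear_combination ha' / 16
    have eb : b' = (11 * x ^ 3 - 12 * x * a) / 64 := by linear_combination hb' / 64
    have hnK (n : ℕ) : (n : ℂ) ∈ K' := natCast_mem K' n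
    have ha'K : a' ∈ K' := by
      rw [ea]
      exact div_mem (sub_mem (mul_mem (hnK 5) (pow_mem hxK' 2)) (mul_mem (hnK 4) haK')) (hnK 16)
    have hb'K : b' ∈ K' := by
      rw [eb]
      exact div_mem (sub_mem (mul_mem (hnK 11) (pow_mem hxK' 3))
        (mul_mem (mul_mem (hnK 12) hxK') haK')) (hnK 64)
    have hfinQ : FiniteDimensional ℚ (IntermediateField.adjoin K {x}) :=
      FiniteDimensional.trans ℚ K _
    refine ⟨K', hfinQ, ?_, ha'K, hb'K, fun σ ↦ ?_⟩
    · change finrank ℚ (IntermediateField.adjoin K {x}) ≤ 3 * m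
      rw [← finrank_mul_finrank ℚ K (IntermediateField.adjoin K {x}), mul_comm]
      gcongr
    · obtain ⟨h4, h6⟩ := hσ (σ.comp (IntermediateField.inclusion hKK').toRingHom)
      change ‖σ ⟨a, haK'⟩‖ ≤ _ at h4
      change ‖σ ⟨b, hbK'⟩‖ ≤ _ at h6
      have e1 : (⟨x, hxK'⟩ : K') ^ 3 = 3 * ⟨a, haK'⟩ * ⟨x, hxK'⟩ + 2 * ⟨b, hbK'⟩ :=
        Subtype.ext hx
      have e2 : 16 * (⟨a', ha'K⟩ : K') = 5 * ⟨x, hxK'⟩ ^ 2 - 4 * ⟨a, haK'⟩ := Subtype.ext ha'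
      have e3 : 64 * (⟨b', hb'K⟩ : K') = 11 * ⟨x, hxK'⟩ ^ 3 - 12 * ⟨x, hxK'⟩ * ⟨a, haK'⟩ :=
        Subtype.ext hb'
      apply_fun σ at e1 e2 e3
      simp only [map_mul, map_add, map_sub, map_pow, map_ofNat] at e1 e2 e3
      generalize σ ⟨a, haK'⟩ = A at *
      generalize σ ⟨b, hbK'⟩ = B at *
      generalize σ ⟨x, hxK'⟩ = y at *
      generalize σ ⟨a', ha'K⟩ = A' at *
      generalize σ ⟨b', hb'K⟩ = B' at *
      have hy := norm_le_of_cubic h4 h6 e1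
      constructor
      · have h1 : 16 * ‖A'‖ ≤ 5 * (2 * R ^ 2) ^ 2 + 4 * R ^ 4 := by
          have : ‖16 * A'‖ ≤ 5 * (2 * R ^ 2) ^ 2 + 4 * R ^ 4 := by
            rw [e2]
            refine (norm_sub_le _ _).trans ?_
            rw [norm_mul, norm_mul, norm_pow]
            norm_num only [Complex.norm_ofNat]
            gcongr
          simpa using this
        have : 0 ≤ R ^ 4 := by positivity
        nlinarith
      · have h1 : 64 * ‖B'‖ ≤ 11 * (2 * R ^ 2) ^ 3 + 12 * (2 * R ^ 2) * R ^ 4 := by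
          have : ‖64 * B'‖ ≤ 11 * (2 * R ^ 2) ^ 3 + 12 * (2 * R ^ 2) * R ^ 4 := by
            rw [e3]
            refine (norm_sub_le _ _).trans ?_
            rw [norm_mul, norm_mul, norm_mul, norm_pow]
            norm_num only [Complex.norm_ofNat]
            gcongr
          simpa using this
        have : 0 ≤ R ^ 6 := by positivity
        nlinarith

theorem Controlled.eisensteinE_pow {q : ℂ} (hq0 : q ≠ 0) (hq1 : ‖q‖ < 1) {u : ℕ} {R : ℝ} {m : ℕ}
    (h : Controlled u R m (eisensteinE (k := 4) (by norm_num) q)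
      (eisensteinE (k := 6) (by norm_num) q)) (s : ℕ) :
    Controlled (2 ^ s * u) (2 ^ s * R) (3 ^ s * m)
      (eisensteinE (k := 4) (by norm_num) (q ^ 2 ^ s))
      (eisensteinE (k := 6) (by norm_num) (q ^ 2 ^ s)) := by
  induction s with
  | zero => simpa using h
  | succ s ih =>
    obtain ⟨x, h1, h2, h3⟩ := exists_eisensteinE_sq (pow_ne_zero (2 ^ s) hq0)
      (norm_pow q (2 ^ s) ▸ pow_lt_one₀ (norm_nonneg q) hq1 (by positivity))
    have := ih.step h1 h2 h3
    rwa [← pow_mul, ← pow_succ, ← mul_assoc, ← mul_assoc, ← mul_assoc, ← pow_succ', ← pow_succ',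
      ← pow_succ'] at this

/-- A lower bound for the values of polynomials with integer coefficients at a point `1 / Q` and
two numbers `a` and `b`. -/
theorem Controlled.one_le_norm_mul_pow {u : ℕ} {R : ℝ} {m : ℕ} {a b : ℂ}
    (h : Controlled u R m a b) (hu : 0 < u) (hR : 1 ≤ R) {L : ℕ} {c : ℕ → ℕ → ℕ → ℤ} {H : ℝ}
    (hL : 0 < L) (hH : 1 ≤ H) (hc : ∀ i j l, |(c i j l : ℝ)| ≤ H) {Q : ℤ} (hQ : Q ≠ 0)
    (hv : ∑ l ∈ Finset.range L, (∑ i ∈ Finset.range L, ∑ j ∈ Finset.range L,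
      (c i j l : ℂ) * (1 / Q) ^ i * a ^ j) * b ^ l ≠ 0) :
    1 ≤ ‖∑ l ∈ Finset.range L, (∑ i ∈ Finset.range L, ∑ j ∈ Finset.range L,
      (c i j l : ℂ) * (1 / Q) ^ i * a ^ j) * b ^ l‖ *
        (|(Q : ℝ)| ^ L * (L ^ 3 * H * (u * R) ^ (10 * L))) ^ m := by
  obtain ⟨ia, ib, K, hK, hm, ha, hb, hσ⟩ := h
  have hNF : NumberField K := ⟨⟩
  have hQ1 : 1 ≤ |(Q : ℝ)| := by exact_mod_cast Int.one_le_abs hQ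
  have hu1 : (1 : ℝ) ≤ u := by exact_mod_cast hu
  have hL1 : (1 : ℝ) ≤ L := by exact_mod_cast hL
  let w : K := (Q : K) ^ L * (u : K) ^ (10 * L) * ∑ l ∈ Finset.range L,
    (∑ i ∈ Finset.range L, ∑ j ∈ Finset.range L,
      (c i j l : K) * (1 / Q) ^ i * ⟨a, ha⟩ ^ j) * ⟨b, hb⟩ ^ l
  set v : ℂ := ∑ l ∈ Finset.range L, (∑ i ∈ Finset.range L, ∑ j ∈ Finset.range L,
      (c i j l : ℂ) * (1 / Q) ^ i * a ^ j) * b ^ l with hvdef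
  -- The image of `w` under an embedding, in a form without denominators.
  have hterm (σ : K →+* ℂ) : σ w = ∑ l ∈ Finset.range L, ∑ i ∈ Finset.range L,
      ∑ j ∈ Finset.range L, (c i j l : ℂ) * (Q : ℂ) ^ (L - i) * (u : ℂ) ^ (10 * L - 4 * j - 6 * l) *
        ((u : ℂ) ^ 4 * σ ⟨a, ha⟩) ^ j * ((u : ℂ) ^ 6 * σ ⟨b, hb⟩) ^ l := by
    simp only [w, map_mul, map_pow, map_sum, map_div₀, map_intCast, map_natCast, map_one]
    rw [Finset.mul_sum]
    refine Finset.sum_congr rfl fun l hl ↦ ?_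
    rw [Finset.sum_mul, Finset.mul_sum]
    refine Finset.sum_congr rfl fun i hi ↦ ?_
    rw [Finset.sum_mul, Finset.mul_sum]
    refine Finset.sum_congr rfl fun j hj ↦ ?_
    rw [Finset.mem_range] at hi hj hl
    obtain ⟨k, hk⟩ := Nat.exists_eq_add_of_le hi.le
    obtain ⟨n, hn⟩ := Nat.exists_eq_add_of_le (show 4 * j + 6 * l ≤ 10 * L by omega)
    have hQ' : (Q : ℂ) ≠ 0 := by exact_mod_cast hQ
    have e1 : (Q : ℂ) ^ L * (1 / Q) ^ i = Q ^ (L - i) := by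
      rw [hk, Nat.add_sub_cancel_left, pow_add, one_div, inv_pow]
      have := pow_ne_zero i hQ'
      field_simp
    have e2 : (u : ℂ) ^ (10 * L) = u ^ (10 * L - 4 * j - 6 * l) * (u ^ 4) ^ j * (u ^ 6) ^ l := by
      rw [← pow_mul, ← pow_mul, ← pow_add, ← pow_add]
      congr 1
      omega
    rw [← e1, e2, mul_pow, mul_pow]
    ring
  have hbase : K.val.toRingHom w = (Q : ℂ) ^ L * (u : ℂ) ^ (10 * L) * v := by
    simp only [w, map_mul, map_pow, map_sum, map_div₀, map_intCast, map_natCast, map_one]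
    rfl
  have hw0 : w ≠ 0 := by
    intro h0
    rw [h0, map_zero] at hbase
    have hQ' : (Q : ℂ) ≠ 0 := by exact_mod_cast hQ
    have hu' : (u : ℂ) ≠ 0 := by exact_mod_cast hu.ne'
    exact mul_ne_zero (mul_ne_zero (pow_ne_zero _ hQ') (pow_ne_zero _ hu')) hv hbase.symm
  have hwi : IsIntegral ℤ w := by
    have h1 : IsIntegral ℤ (K.val.toRingHom w) := by
      rw [hterm]
      refine IsIntegral.sum _ fun l _ ↦ IsIntegral.sum _ fun i _ ↦ IsIntegral.sum _ fun j _ ↦ ?_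
      refine (((IsIntegral.mul ?_ ?_).mul ?_).mul ?_).mul ?_
      · exact isIntegral_algebraMap (R := ℤ) (A := ℂ) (x := c i j l)
      · exact (isIntegral_algebraMap (R := ℤ) (A := ℂ) (x := Q)).pow _
      · exact (isIntegral_natCast u).pow _
      · exact ia.pow j
      · exact ib.pow l
    exact (isIntegral_algebraMap_iff (R := ℤ) (A := K) (B := ℂ) Subtype.val_injective).mp h1
  set B : ℝ := |(Q : ℝ)| ^ L * (L ^ 3 * H * (u * R) ^ (10 * L)) with hB
  have hwB (σ : K →+* ℂ) : ‖σ w‖ ≤ B := by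
    obtain ⟨h4, h6⟩ := hσ σ
    have key : ∀ l ∈ Finset.range L, ∀ i ∈ Finset.range L, ∀ j ∈ Finset.range L,
        ‖(c i j l : ℂ) * (Q : ℂ) ^ (L - i) * (u : ℂ) ^ (10 * L - 4 * j - 6 * l) *
          ((u : ℂ) ^ 4 * σ ⟨a, ha⟩) ^ j * ((u : ℂ) ^ 6 * σ ⟨b, hb⟩) ^ l‖ ≤
        H * |(Q : ℝ)| ^ L * (u * R) ^ (10 * L) := by
      intro l hl i hi j hj
      rw [Finset.mem_range] at hi hj hl
      simp only [norm_mul, norm_pow, Complex.norm_intCast, Complex.norm_natCast]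
      have hsplit : ((u : ℝ) * R) ^ (10 * L) = (u * R) ^ (10 * L - 4 * j - 6 * l) *
          (u ^ 4 * R ^ 4) ^ j * (u ^ 6 * R ^ 6) ^ l := by
        rw [← mul_pow, ← mul_pow, ← pow_mul, ← pow_mul, ← pow_add, ← pow_add]
        congr 1
        omega
      rw [hsplit, ← mul_assoc, ← mul_assoc]
      have hule : (u : ℝ) ≤ u * R := le_mul_of_one_le_right (by positivity) hR
      gcongr
      · exact hc i j l
      · omega
    rw [hterm]
    refine (norm_sum_le_of_le _ fun l hl ↦ norm_sum_le_of_le _ fun i hi ↦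
      norm_sum_le_of_le _ fun j hj ↦ key l hl i hi j hj).trans (le_of_eq ?_)
    simp only [Finset.sum_const, Finset.card_range, nsmul_eq_mul, hB]
    ring
  have hmain := one_le_norm_mul_pow_of_isIntegral K.val.toRingHom hwi hw0 hwB
  have hLH : (1 : ℝ) ≤ L ^ 3 * H := one_le_mul_of_one_le_of_one_le (one_le_pow₀ hL1) hH
  have hpre : ‖(Q : ℂ) ^ L * (u : ℂ) ^ (10 * L)‖ ≤ B := by
    rw [norm_mul, norm_pow, norm_pow, Complex.norm_intCast, Complex.norm_natCast, hB]
    gcongr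
    calc (u : ℝ) ^ (10 * L) ≤ (u * R) ^ (10 * L) := by
          gcongr
          exact le_mul_of_one_le_right (by positivity) hR
      _ ≤ _ := le_mul_of_one_le_left (by positivity) hLH
  have hB1 : 1 ≤ B := by
    have huR : 1 ≤ (u : ℝ) * R := one_le_mul_of_one_le_of_one_le hu1 hR
    exact one_le_mul_of_one_le_of_one_le (one_le_pow₀ hQ1)
      (one_le_mul_of_one_le_of_one_le hLH (one_le_pow₀ huR))
  have hpos : 0 < finrank ℚ K := finrank_pos
  calc 1 ≤ _ := hmain
    _ = ‖v‖ * (‖(Q : ℂ) ^ L * (u : ℂ) ^ (10 * L)‖ * B ^ (finrank ℚ K - 1)) := by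
      rw [hbase, norm_mul]
      ring
    _ ≤ ‖v‖ * (B * B ^ (finrank ℚ K - 1)) := by gcongr
    _ = ‖v‖ * B ^ finrank ℚ K := by rw [← pow_succ', Nat.sub_add_cancel hpos]
    _ ≤ ‖v‖ * B ^ m := by gcongr

end Tower

/-! ### Comparison of the upper and lower bounds -/

section Comparison

theorem discEval_auxSeries {z : ℂ} (hz0 : z ≠ 0) (hz : ‖z‖ < 1) (L : ℕ) (c : ℕ → ℕ → ℕ → ℤ) :
    discEval z hz (auxSeries L L c) = ∑ l ∈ Finset.range L, (∑ i ∈ Finset.range L,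
      ∑ j ∈ Finset.range L, (c i j l : ℂ) * z ^ i * eisensteinE (k := 4) (by norm_num) z ^ j) *
        eisensteinE (k := 6) (by norm_num) z ^ l := by
  simp only [auxSeries, map_sum, map_mul, map_pow, map_intCast, discEval_seriesX,
    discEval_seriesE4 hz0, discEval_seriesE6 hz0]

theorem exists_coeff_ne_zero {f : discSubring} (hf : f ≠ 0) {B : ℕ}
    (h : ∀ n < B, PowerSeries.coeff n (f : PowerSeries ℤ) = 0) :
    ∃ M, B ≤ M ∧ (∀ n < M, PowerSeries.coeff n (f : PowerSeries ℤ) = 0) ∧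
      PowerSeries.coeff M (f : PowerSeries ℤ) ≠ 0 := by
  classical
  have hex : ∃ M, PowerSeries.coeff M (f : PowerSeries ℤ) ≠ 0 := by
    by_contra! h0
    exact hf (Subtype.ext (PowerSeries.ext h0))
  refine ⟨Nat.find hex, ?_, fun n hn ↦ not_not.mp (Nat.find_min hex hn), Nat.find_spec hex⟩
  by_contra! hlt
  exact Nat.find_spec hex (h _ hlt)

/-- The smallest exponent of the form `2 ^ s` beyond a given bound. -/
theorem exists_two_pow_two_pow (W : ℝ) :
    ∃ s : ℕ, W ≤ 2 ^ 2 ^ s ∧ ((2 : ℝ) ^ 2 ^ s ≤ 2 ∨ (2 : ℝ) ^ 2 ^ s ≤ W ^ 2) := by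
  classical
  have hex : ∃ s : ℕ, W ≤ 2 ^ 2 ^ s := by
    obtain ⟨n, hn⟩ := pow_unbounded_of_one_lt W (one_lt_two (α := ℝ))
    exact ⟨n, hn.le.trans (pow_le_pow_right₀ one_le_two Nat.lt_two_pow_self.le)⟩
  refine ⟨Nat.find hex, Nat.find_spec hex, ?_⟩
  rcases h : Nat.find hex with _ | s
  · left
    norm_num
  · right
    have := not_le.mp (Nat.find_min hex (m := s) (by omega))
    rw [pow_succ 2 s, pow_mul]
    gcongr

/-- The order of vanishing `M` of the auxiliary function is bounded in terms of the exponent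
`2 ^ s` for which the function is known not to vanish at `q ^ 2 ^ s`. -/
theorem exists_order_le {N : ℤ} (hN : 2 ≤ |N|) {u : ℕ} {R : ℝ} {m : ℕ} (hu : 0 < u) (hR : 1 ≤ R)
    (hm : 0 < m) (h : Controlled u R m (eisensteinE (k := 4) (by norm_num) (1 / N))
      (eisensteinE (k := 6) (by norm_num) (1 / N))) {K : ℕ} (hK : 4 ≤ K)
    (hKn : ∀ n ≥ K, (n : ℝ) ^ 2 * (u * R) ≤ 2 ^ n) :
    ∃ M s : ℕ, 4 * K ^ 3 ≤ M ∧ M ≤ 25 * K * m * 3 ^ s ∧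
      (2 : ℝ) ^ 2 ^ s ≤ ((2 * (M + 1)) ^ (67 * K)) ^ 2 := by
  obtain ⟨c, hc0, hcM, hcH⟩ := exists_auxSeries (K := K) (by omega)
  obtain ⟨M, hKM, hM0, hM⟩ := exists_coeff_ne_zero hc0 hcM
  set H : ℤ := 8 * K ^ 3 * (504 ^ (4 * K) * (4 * K ^ 3) ^ (28 * K)) with hH
  have hbound := coeffBound_auxSeries (L := 2 * K) hcH
  set T : ℤ := ((2 * K : ℕ) : ℤ) ^ 3 * H * 504 ^ (2 * (2 * K)) with hT
  set W : ℝ := 4 * T * (2 * (M + 1)) ^ (14 * (2 * K)) with hW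
  have hK1 : (1 : ℤ) ≤ K := by omega
  have hK3 : (1 : ℤ) ≤ K ^ 3 := one_le_pow₀ hK1
  have hH1 : 1 ≤ H := by
    rw [hH]
    exact one_le_mul_of_one_le_of_one_le (by omega)
      (one_le_mul_of_one_le_of_one_le (one_le_pow₀ (by norm_num)) (one_le_pow₀ (by omega)))
  have hHT : ((2 * K : ℕ) : ℤ) ^ 3 * H ≤ T :=
    le_mul_of_one_le_right (by positivity) (one_le_pow₀ (by norm_num))
  have hT1 : 1 ≤ T := by
    refine le_trans (one_le_mul_of_one_le_of_one_le (one_le_pow₀ ?_) hH1) hHT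
    push_cast
    omega
  have hT1' : (1 : ℝ) ≤ T := by exact_mod_cast hT1
  have hY1 : (2 : ℝ) ≤ 2 * (M + 1) := by
    have : (0 : ℝ) ≤ M := Nat.cast_nonneg M
    linarith
  have hYpow : (2 : ℝ) ^ (14 * (2 * K)) ≤ (2 * (M + 1)) ^ (14 * (2 * K)) := by gcongr
  have hY0 : (1 : ℝ) ≤ (2 * (M + 1)) ^ (14 * (2 * K)) := one_le_pow₀ (by linarith)
  have hTW : (T : ℝ) ≤ W := by
    rw [hW, mul_assoc, mul_comm (4 : ℝ), mul_assoc]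
    exact le_mul_of_one_le_right (by linarith) (by linarith)
  -- The size of the parameter `W` in terms of `Y = 2 * (M + 1)`.
  have hWY : W ≤ (2 * (M + 1)) ^ (67 * K) := by
    set Y : ℝ := 2 * (M + 1) with hYdef
    have hKY : 8 * (K : ℝ) ^ 3 ≤ Y := by
      have : (4 * K ^ 3 : ℝ) ≤ M := by exact_mod_cast hKM
      linarith
    have hK4 : (4 : ℝ) ≤ K := by exact_mod_cast hK
    have hK64 : (4 : ℝ) ^ 3 ≤ K ^ 3 := by gcongr
    have h504 : 504 ≤ Y := by linarith
    have e : W = 4 * (8 * (K : ℝ) ^ 3) * (8 * (K : ℝ) ^ 3) * 504 ^ (8 * K) *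
        (4 * (K : ℝ) ^ 3) ^ (28 * K) * Y ^ (28 * K) := by
      rw [hW, hT, hH]
      push_cast
      rw [show 8 * K = 4 * K + 2 * (2 * K) by ring, show 14 * (2 * K) = 28 * K by ring, pow_add]
      ring
    calc W = _ := e
      _ ≤ Y * Y * Y * Y ^ (8 * K) * Y ^ (28 * K) * Y ^ (28 * K) := by
        gcongr
        · linarith
        · linarith
      _ = Y ^ (3 + (8 * K + 28 * K + 28 * K)) := by
        rw [pow_add, pow_add, pow_add]
        ring
      _ ≤ Y ^ (67 * K) := pow_le_pow_right₀ (by linarith) (by omega)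
  obtain ⟨s, hs, hs'⟩ := exists_two_pow_two_pow W
  refine ⟨M, s, hKM, ?_, ?_⟩
  swap
  · rcases hs' with hs' | hs'
    · refine hs'.trans ?_
      rw [← pow_mul]
      exact hY1.trans (le_self_pow₀ (by linarith) (by omega))
    · refine hs'.trans ?_
      have : 0 ≤ W := by linarith
      gcongr
  set n := 2 ^ s with hn
  have hN0 : N ≠ 0 := by
    rintro rfl
    norm_num at hN
  have hQ0 : N ^ n ≠ 0 := pow_ne_zero _ hN0
  set A : ℝ := |((N ^ n : ℤ) : ℝ)| with hA
  have hAN : (2 : ℝ) ^ n ≤ A := by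
    have : (2 : ℝ) ≤ |(N : ℝ)| := by exact_mod_cast hN
    rw [hA, Int.cast_pow, abs_pow]
    gcongr
  have hWA : W ≤ A := hs.trans hAN
  have hA0 : 0 < A := by linarith
  have hA1 : 1 ≤ A := by linarith
  have hKn' : K ≤ n := by
    have h1 : (2 : ℝ) ^ (14 * (2 * K)) ≤ 2 ^ n := by
      refine le_trans ?_ hs
      rw [hW]
      exact hYpow.trans (le_mul_of_one_le_left (by positivity) (by linarith))
    have := (pow_le_pow_iff_right₀ (one_lt_two (α := ℝ))).mp h1
    omega
  set z : ℂ := (1 / (N : ℂ)) ^ n with hz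
  have hzQ : z = 1 / ((N ^ n : ℤ) : ℂ) := by
    rw [hz, one_div_pow]
    push_cast
    rfl
  have hzA : ‖z‖ = 1 / A := by
    rw [hzQ, norm_div, norm_one, Complex.norm_intCast]
  have hNC : (N : ℂ) ≠ 0 := by exact_mod_cast hN0
  have hq0 : (1 / (N : ℂ)) ≠ 0 := one_div_ne_zero hNC
  have hq1 : ‖1 / (N : ℂ)‖ < 1 := by
    have : (2 : ℝ) ≤ |(N : ℝ)| := by exact_mod_cast hN
    rw [norm_div, norm_one, Complex.norm_intCast, div_lt_one (by linarith)]
    linarith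
  have hz0 : z ≠ 0 := pow_ne_zero _ hq0
  have hz1 : ‖z‖ < 1 := by
    rw [hz, norm_pow]
    exact pow_lt_one₀ (norm_nonneg _) hq1 (by positivity)
  obtain ⟨hne, hle⟩ := discEval_ne_zero_and_norm_le hbound hM0 hM hz0 hz1 (by
    rw [hzA, one_div, inv_mul_le_one₀ hA0]
    exact hWA)
  have hle' : ‖discEval z hz1 (auxSeries (2 * K) (2 * K) c)‖ ≤ W / A ^ M := by
    refine hle.trans ?_
    rw [hzA, one_div_pow, one_div, inv_mul_eq_div]
    gcongr
    rw [hW]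
    have : ((M : ℝ) + 1) ^ (14 * (2 * K)) ≤ (2 * (M + 1)) ^ (14 * (2 * K)) := by
      gcongr
      linarith
    have h2 : 0 ≤ (T : ℝ) * (2 * (M + 1)) ^ (14 * (2 * K)) := by positivity
    calc 2 * (T : ℝ) * (M + 1) ^ (14 * (2 * K)) ≤ 2 * T * (2 * (M + 1)) ^ (14 * (2 * K)) := by
          gcongr
      _ ≤ _ := by linarith
  have hctrl := h.eisensteinE_pow hq0 hq1 s
  rw [discEval_auxSeries hz0 hz1] at hne hle'
  have hLiou := hctrl.one_le_norm_mul_pow (L := 2 * K) (c := c) (H := H) (Q := N ^ n)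
    (by positivity) (one_le_mul_of_one_le_of_one_le (one_le_pow₀ one_le_two) hR) (by omega)
    (by exact_mod_cast hH1) (fun i j l ↦ by exact_mod_cast hcH i j l) hQ0
    (by rw [← hzQ]; exact hne)
  rw [← hzQ] at hLiou
  -- All factors of the lower bound are absorbed by powers of `A`, the denominator of `z`.
  have hB : A ^ (2 * K) * (((2 * K : ℕ) : ℝ) ^ 3 * H *
      (((2 ^ s * u : ℕ) : ℝ) * (2 ^ s * R)) ^ (10 * (2 * K))) ≤ A ^ (24 * K) := by
    have h1 : ((2 * K : ℕ) : ℝ) ^ 3 * H ≤ A := by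
      refine le_trans ?_ (hTW.trans hWA)
      exact_mod_cast hHT
    have h2 : ((2 ^ s * u : ℕ) : ℝ) * (2 ^ s * R) ≤ A := by
      refine le_trans (le_of_eq ?_) ((hKn n hKn').trans hAN)
      push_cast [hn]
      ring
    have hH0 : (0 : ℝ) ≤ H := by
      have : (0 : ℤ) ≤ H := by omega
      exact_mod_cast this
    calc _ ≤ A ^ (2 * K) * (A * A ^ (10 * (2 * K))) := by gcongr
      _ = A ^ (2 * K + (10 * (2 * K) + 1)) := by
        rw [pow_add, pow_succ]
        ring
      _ ≤ A ^ (24 * K) := pow_le_pow_right₀ hA1 (by omega)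
  have hfin : A ^ M ≤ A ^ (1 + 24 * K * (3 ^ s * m)) := by
    have h1 := hLiou.trans (mul_le_mul hle' (pow_le_pow_left₀ (by positivity) hB (3 ^ s * m))
      (by positivity) (by positivity))
    rw [div_mul_eq_mul_div, one_le_div (by positivity)] at h1
    refine h1.trans ?_
    rw [pow_add, pow_one, pow_mul A (24 * K)]
    gcongr
  have hA2 : 1 < A := by
    refine lt_of_lt_of_le ?_ hAN
    exact one_lt_pow₀ one_lt_two (by positivity)
  have hfin' := (pow_le_pow_iff_right₀ hA2).mp hfin
  have : 0 < 3 ^ s * m := by positivity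
  have h1 : 1 ≤ K * (3 ^ s * m) := Nat.mul_pos (by omega) this
  calc M ≤ 1 + 24 * K * (3 ^ s * m) := hfin'
    _ ≤ K * (3 ^ s * m) + 24 * K * (3 ^ s * m) := by omega
    _ = 25 * K * m * 3 ^ s := by ring

/-- The bounds of `exists_order_le` are incompatible for large `K`: with `Y = 2 * (M + 1)` they
give `2 ^ s = O(K * log Y)` and `Y = O(K * 3 ^ s)`, hence `Y ^ 3 = O(K ^ 8 * (log Y) ^ 5)` because
`3 ^ 3 ≤ 2 ^ 5`, while `K ^ 3 ≤ Y`. -/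
theorem not_forall_exists_order_le (m : ℕ) : ¬ ∀ᶠ K : ℕ in Filter.atTop, ∃ M s : ℕ,
    4 * K ^ 3 ≤ M ∧ M ≤ 25 * K * m * 3 ^ s ∧
      (2 : ℝ) ^ 2 ^ s ≤ ((2 * (M + 1)) ^ (67 * K)) ^ 2 := by
  intro hev
  set C : ℝ := (((52 * (m + 1)) ^ 3 * 134 ^ 5 * (2 ^ 5) : ℕ) : ℝ) with hC
  have hC0 : 0 < C := by
    rw [hC]
    exact_mod_cast (by positivity)
  have hlog : ∀ᶠ y : ℝ in Filter.atTop, C ^ 3 * Real.log y ^ 15 < y := by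
    have h1 := (Real.isLittleO_pow_log_id_atTop (n := 15)).bound
      (show (0 : ℝ) < 1 / (2 * C ^ 3) by positivity)
    filter_upwards [h1, Filter.eventually_gt_atTop 1] with y hy hy1
    have hl : 0 ≤ Real.log y := Real.log_nonneg hy1.le
    rw [Real.norm_of_nonneg (by positivity), id, Real.norm_of_nonneg (by linarith)] at hy
    calc C ^ 3 * Real.log y ^ 15 ≤ C ^ 3 * (1 / (2 * C ^ 3) * y) := by gcongr
      _ = y / 2 := by field_simp
      _ < y := by linarith
  obtain ⟨y0, hy0⟩ := Filter.eventually_atTop.mp hlog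
  obtain ⟨K, ⟨M, s, hKM, hMs, hs⟩, hK1, hKy⟩ := (hev.and ((Filter.eventually_ge_atTop 1).and
    (tendsto_natCast_atTop_atTop.eventually_ge_atTop y0))).exists
  set Y : ℝ := 2 * (M + 1) with hY
  have hK1' : (1 : ℝ) ≤ K := by exact_mod_cast hK1
  have hKM' : 4 * (K : ℝ) ^ 3 ≤ M := by exact_mod_cast hKM
  have hMs' : (M : ℝ) ≤ 25 * K * m * 3 ^ s := by exact_mod_cast hMs
  have hK3 : (K : ℝ) ≤ K ^ 3 := le_self_pow₀ hK1' (by norm_num)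
  have hKY : (K : ℝ) ^ 3 ≤ Y := by linarith
  have hYpos : 0 < Y := by linarith
  have hlt := hy0 Y (by linarith)
  have hlogY : 0 ≤ Real.log Y := Real.log_nonneg (by linarith)
  have h3s : (1 : ℝ) ≤ 3 ^ s := one_le_pow₀ (by norm_num)
  have hYs : Y ≤ 52 * (m + 1) * K * 3 ^ s := by
    have h1 : 1 ≤ (K : ℝ) * 3 ^ s := one_le_mul_of_one_le_of_one_le hK1' h3s
    have h2 : 0 ≤ (m : ℝ) * (K * 3 ^ s) := by positivity
    rw [hY]
    nlinarith
  have hns : (2 : ℝ) ^ s ≤ 134 * 2 * K * Real.log Y := by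
    have h1 := Real.log_le_log (by positivity) hs
    rw [← pow_mul, Real.log_pow, Real.log_pow] at h1
    have h2 : (1 : ℝ) / 2 < Real.log 2 := by
      have := Real.log_two_gt_d9
      linarith
    have h3 : (2 : ℝ) ^ s * (1 / 2) ≤ 2 ^ s * Real.log 2 := by gcongr
    push_cast at h1
    linarith
  have h27 : ((3 : ℝ) ^ s) ^ 3 ≤ ((2 : ℝ) ^ s) ^ 5 := by
    rw [← pow_mul, ← pow_mul, mul_comm s 3, mul_comm s 5, pow_mul, pow_mul]
    gcongr
    norm_num
  have hY3 : Y ^ 3 ≤ C * (K ^ 8 * Real.log Y ^ 5) := by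
    calc Y ^ 3 ≤ (52 * (m + 1) * K * 3 ^ s) ^ 3 := by gcongr
      _ = (52 * (m + 1) * K) ^ 3 * ((3 : ℝ) ^ s) ^ 3 := by ring
      _ ≤ (52 * (m + 1) * K) ^ 3 * (134 * 2 * K * Real.log Y) ^ 5 := by
        gcongr
        exact h27.trans (by gcongr)
      _ = C * (K ^ 8 * Real.log Y ^ 5) := by
        rw [hC]
        push_cast
        ring
  have hY9 : Y ^ 9 ≤ Y ^ 8 * (C ^ 3 * Real.log Y ^ 15) := by
    calc Y ^ 9 = (Y ^ 3) ^ 3 := by ring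
      _ ≤ (C * (K ^ 8 * Real.log Y ^ 5)) ^ 3 := by gcongr
      _ = ((K : ℝ) ^ 3) ^ 8 * (C ^ 3 * Real.log Y ^ 15) := by ring
      _ ≤ Y ^ 8 * (C ^ 3 * Real.log Y ^ 15) := by gcongr
  have : Y ^ 8 * (C ^ 3 * Real.log Y ^ 15) < Y ^ 8 * Y := by gcongr
  rw [← pow_succ] at this
  exact absurd this hY9.not_gt

end Comparison

theorem mainTheorem2 (q : ℂ) (hq0 : q ≠ 0) (hq1 : q ≠ 1) (hq2 : q ≠ -1)
    (hq : ∃ N : ℤ, 1 / q = (N : ℂ)) :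
    Transcendental ℚ (eisensteinE (k := 4) (by norm_num) q) ∨
      Transcendental ℚ (eisensteinE (k := 6) (by norm_num) q) := by
  by_contra! hcon
  obtain ⟨h4, h6⟩ := hcon
  obtain ⟨N, hN⟩ := hq
  have hqN : q = 1 / (N : ℂ) := by rw [← hN, one_div_one_div]
  subst hqN
  have hN2 : 2 ≤ |N| := by
    by_contra! hlt
    have h1 := abs_lt.mp hlt
    obtain rfl | rfl | rfl : N = -1 ∨ N = 0 ∨ N = 1 := by omega
    · norm_num at hq2
    · norm_num at hq0
    · norm_num at hq1
  obtain ⟨u, R, m, hu, hR, hm, hc⟩ := exists_controlled (not_not.mp h4) (not_not.mp h6)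
  refine not_forall_exists_order_le m ?_
  have hgrowth : ∀ᶠ n : ℕ in Filter.atTop, (n : ℝ) ^ 2 * (u * R) ≤ 2 ^ n := by
    have huR : 0 < (u : ℝ) * R := by positivity
    have h1 := (isLittleO_pow_const_const_pow_of_one_lt (R := ℝ) 2 (one_lt_two (α := ℝ))).bound
      (show (0 : ℝ) < 1 / (u * R) by positivity)
    filter_upwards [h1] with n hn
    rw [Real.norm_of_nonneg (by positivity), Real.norm_of_nonneg (by positivity),
      one_div, inv_mul_eq_div, le_div_iff₀ huR] at hn
    exact hn
  obtain ⟨n0, hn0⟩ := Filter.eventually_atTop.mp hgrowth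
  filter_upwards [Filter.eventually_ge_atTop (max 4 n0)] with K hK
  exact exists_order_le hN2 hu hR hm hc ((le_max_left _ _).trans hK)
    fun n hn ↦ hn0 n (((le_max_right _ _).trans hK).trans hn)
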